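/- Notation. For $m\ge 1$ let $E(m)\in\mathbb{R}^{m\times m}$ be the matrix with ones on the anti-diagonal and zeros elsewhere, and let $G(m)=\mathrm{Diag}\{I_{\lceil m/2\rceil},-I_{\lfloor m/2\rfloor}\}$. For $\lambda\in\mathbb{R}$ let $J(\lambda,m)\in\mathbb{R}^{m\times m}$ be the Jordan block with $\lambda$ on the diagonal and $1$ on the superdiagonal. For $\lambda=a+b\,i\in\mathbb{C}\setminus\mathbb{R}$ and $m$ even let $J(\lambda,m)\in\mathbb{R}^{m\times m}$ be the real Jordan block with $2\times2$ blocks $\begin{pmatrix}a&-b\\ b&a\end{pmatrix}$ on the block diagonal and $I_2$ on the block superdiagonal. Lemma. Let $A,B\in\mathbb{R}^{m\times m}$ be symmetric with $A$ nonsingular. Let $A^{-1}B$ have the real Jordan normal form $\mathrm{Diag}\{J(\lambda_1,m_1),\dots,J(\lambda_r,m_r),J(\lambda_{r+1},m_{r+1}),\dots,J(\lambda_p,m_p)\}$ with $\lambda_1,\dots,\lambda_r\in\mathbb{R}$ and $\lambda_{r+1},\dots,\lambda_p\in\mathbb{C}\setminus\mathbb{R}$ (one block for each pair of conjugate Jordan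 blocks). Call $\sigma_1,\dots,\sigma_r\in\{1,-1\}$ canonical signs of $(A,B)$ if there is a nonsingular $\tilde P\in\mathbb{R}^{m\times m}$ with $$\tilde P^{\mathsf T}A\tilde P=\mathrm{Diag}\{\sigma_1E(m_1),\dots,\sigma_rE(m_r),E(m_{r+1}),\dots,E(m_p)\},$$ $$\tilde P^{\mathsf T}B\tilde P=\mathrm{Diag}\{\sigma_1E(m_1)J(\lambda_1,m_1),\dots,\sigma_rE(m_r)J(\lambda_r,m_r),E(m_{r+1})J(\lambda_{r+1},m_{r+1}),\dots,E(m_p)J(\lambda_p,m_p)\}.$$ Then canonical signs exist, and for all canonical signs $\sigma_1,\dots,\sigma_r$ there is a sequence $(P_k)_{k\ge1}$ in $\mathrm{GL}_m(\mathbb{R})$, with $\det P_k$ independent of $k$, such that $$P_k^{\mathsf T}AP_k=\mathrm{Diag}\{\sigma_1G(m_1),\dots,\sigma_rG(m_r),E(m_{r+1}),\dots,E(m_p)\}\quad\text{for all }k,$$ $$\lim_{k\to\infty}P_k^{\mathsf T}BP_k=\mathrm{Diag}\{\lambda_1\sigma_1G(m_1),\dots,\lambda_r\sigma_rG(m_r),E(m_{r+1})J(\lambda_{r+1},m_{r+1}),\dots,E(m_p)J(\lambda_p,m_p)\}.$$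 -/

import Mathlib

open scoped Matrix
open Filter Topology

/-- The anti-diagonal matrix `E(m)`: ones on the anti-diagonal, zeros elsewhere. -/
def exchangeMat (m : ℕ) : Matrix (Fin m) (Fin m) ℝ :=
  Matrix.of fun i j => if (i : ℕ) + (j : ℕ) + 1 = m then 1 else 0

/-- The matrix `G(m) = Diag(I_⌈m/2⌉, -I_⌊m/2⌋)`. -/
def signMat (m : ℕ) : Matrix (Fin m) (Fin m) ℝ :=
  Matrix.diagonal fun i => if (i : ℕ) < (m + 1) / 2 then 1 else -1

/-- The `m × m` Jordan block with real eigenvalue `c`: `c` on the diagonal and `1` on the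
superdiagonal. -/
def realEigJordanBlock (c : ℝ) (m : ℕ) : Matrix (Fin m) (Fin m) ℝ :=
  Matrix.of fun i j => if i = j then c else if (j : ℕ) = (i : ℕ) + 1 then 1 else 0

/-- The `m × m` real Jordan block of the pair `a ± b i` (used for `b ≠ 0` and `m` even):
`2 × 2` blocks `[a, -b; b, a]` on the block diagonal and `I₂` on the block superdiagonal. -/
def complexEigJordanBlock (a b : ℝ) (m : ℕ) : Matrix (Fin m) (Fin m) ℝ :=
  Matrix.of fun i j =>
    if (i : ℕ) / 2 = (j : ℕ) / 2 then
      (if i = j then a else if i < j then -b else b)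
    else if (j : ℕ) = (i : ℕ) + 2 then 1 else 0

open Classical in
/-- The real Jordan block `J(z, m)`, of size `m × m`. -/
noncomputable def jordanBlock (z : ℂ) (m : ℕ) : Matrix (Fin m) (Fin m) ℝ :=
  if z.im = 0 then realEigJordanBlock z.re m else complexEigJordanBlock z.re z.im m

/-- `Diag{X_1, …, X_p}`, as a matrix indexed by `Fin m` with `m = d_1 + ⋯ + d_p`, the blocks
being placed in order along the diagonal. -/
def blockDiag {p m : ℕ} {d : Fin p → ℕ} (h : ∑ s, d s = m)
    (X : (s : Fin p) → Matrix (Fin (d s)) (Fin (d s)) ℝ) : Matrix (Fin m) (Fin m) ℝ :=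
  Matrix.reindex (finSigmaFinEquiv.trans (finCongr h)) (finSigmaFinEquiv.trans (finCongr h))
    (Matrix.blockDiagonal' X)

/-- `Diag{J(lam_1, d_1), …, J(lam_p, d_p)}` is a real Jordan normal form of `M`, with
`lam_1, …, lam_r` real and `lam_{r+1}, …, lam_p` non-real. All blocks are non-empty, and those of
non-real eigenvalues have even size. -/
def IsRealJordanForm {m p : ℕ} (M : Matrix (Fin m) (Fin m) ℝ) (r : ℕ) (lam : Fin p → ℂ)
    (d : Fin p → ℕ) (h : ∑ s, d s = m) : Prop :=
  r ≤ p ∧ (∀ s, 0 < d s) ∧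
  (∀ s : Fin p, (s : ℕ) < r → (lam s).im = 0) ∧
  (∀ s : Fin p, r ≤ (s : ℕ) → (lam s).im ≠ 0 ∧ Even (d s)) ∧
  ∃ S : Matrix.GeneralLinearGroup (Fin m) ℝ,
    (S : Matrix (Fin m) (Fin m) ℝ)⁻¹ * M * (S : Matrix (Fin m) (Fin m) ℝ) =
      blockDiag h fun s => jordanBlock (lam s) (d s)

/-- `σ_1, …, σ_r ∈ {1, -1}` are signs of the canonical form of the pair `(A, B)` under congruence:
some nonsingular `P` brings `A` to `Diag{σ_s E(d_s) (s ≤ r), E(d_s) (s > r)}` and `B` to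
`Diag{σ_s E(d_s) J(lam_s, d_s) (s ≤ r), E(d_s) J(lam_s, d_s) (s > r)}`.
The values `σ_s` with `s > r` play no role. -/
def IsCanonicalSigns {m p : ℕ} (A B : Matrix (Fin m) (Fin m) ℝ) (r : ℕ) (lam : Fin p → ℂ)
    (d : Fin p → ℕ) (h : ∑ s, d s = m) (σ : Fin p → ℝ) : Prop :=
  (∀ s : Fin p, (s : ℕ) < r → σ s = 1 ∨ σ s = -1) ∧
  ∃ P : Matrix.GeneralLinearGroup (Fin m) ℝ,
    (P : Matrix (Fin m) (Fin m) ℝ)ᵀ * A * (P : Matrix (Fin m) (Fin m) ℝ) =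
      (blockDiag h fun s =>
        if (s : ℕ) < r then σ s • exchangeMat (d s) else exchangeMat (d s)) ∧
    (P : Matrix (Fin m) (Fin m) ℝ)ᵀ * B * (P : Matrix (Fin m) (Fin m) ℝ) =
      (blockDiag h fun s =>
        if (s : ℕ) < r then σ s • (exchangeMat (d s) * jordanBlock (lam s) (d s))
        else exchangeMat (d s) * jordanBlock (lam s) (d s))

/-! In a Jordan basis of A⁻¹B, with Jordan matrix J, the pair (A, B) becomes (A', A'J), and symmetry
of B says exactly that A'J = JᵀA'. Hence B follows A automatically: canonical signs exist once A' is
reduced to the blocks ±E by congruences that commute with J.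

The commutant R of a single block is local and commutative. With N the nilpotent shift, it is ℝ[N]
for a real eigenvalue and ℂ[N], written in real 2 × 2 blocks, for a conjugate pair; all its elements
are self-adjoint for E. So E times a diagonal block of A' lies in R and is a unit or nilpotent. This
lets Gram–Schmidt run block by block: `exists_congr_isUnit_blk` produces an invertible diagonal
block, and `exists_congr_split_block` splits it off. What remains on a block is E·u with u a unit of
R. Congruence by q in R replaces u by uq², and Newton's method, started at the constant term, brings
uq² to ±1 in ℝ[N] and to 1 in ℂ[N].

For the limit, conjugation by the diagonal matrix with entries t^(m-1-2i) fixes E, has determinant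
1, and multiplies EN by t⁻². Thus EJ = cE + EN tends to cE as t → ∞, while a fixed congruence turns
E into G (`exists_seq_congr_tendsto`). Blocks with non-real eigenvalues are left alone. -/

/-! ### Polynomials in the nilpotent shift: commutant, units and square roots. -/

section ShiftMatrix

open Polynomial

variable {K : Type*} [Field K]

/-- The nilpotent shift: ones on the superdiagonal, zeros elsewhere. -/
def shiftMat (K : Type*) [Field K] (k : ℕ) : Matrix (Fin k) (Fin k) K :=
  Matrix.of fun i j => if (j : ℕ) = (i : ℕ) + 1 then 1 else 0

theorem shiftMat_apply (k : ℕ) (i j : Fin k) :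
    shiftMat K k i j = if (j : ℕ) = (i : ℕ) + 1 then 1 else 0 := rfl

theorem shiftMat_pow_apply (k l : ℕ) (i j : Fin k) :
    (shiftMat K k ^ l) i j = if (j : ℕ) = (i : ℕ) + l then 1 else 0 := by
  induction l generalizing i j with
  | zero => simp [Matrix.one_apply, Fin.ext_iff, eq_comm]
  | succ l ih =>
    rw [pow_succ', Matrix.mul_apply]
    simp only [ih, shiftMat_apply, ite_mul, one_mul, zero_mul]
    by_cases h : (i : ℕ) + 1 < k
    · rw [Finset.sum_eq_single ⟨i + 1, h⟩]
      · simp only [if_true]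
        congr 1
        simp only [eq_iff_iff]
        omega
      · intro b _ hb
        rw [if_neg]
        intro hb'
        exact hb (Fin.ext hb')
      · simp
    · rw [Finset.sum_eq_zero, if_neg]
      · have := j.2
        omega
      · intro b _
        rw [if_neg]
        have := b.2
        omega

theorem shiftMat_pow_self (k : ℕ) : shiftMat K k ^ k = 0 := by
  ext i j
  rw [shiftMat_pow_apply, if_neg (by have := j.2; omega)]
  rfl

theorem isNilpotent_shiftMat (k : ℕ) : IsNilpotent (shiftMat K k) :=
  ⟨k, shiftMat_pow_self k⟩

theorem commute_shiftMat_aeval (k : ℕ) (g : K[X]) :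
    Commute (shiftMat K k) (aeval (shiftMat K k) g) := by
  have := Commute.map (Commute.all (X : K[X]) g) (aeval (shiftMat K k))
  simpa using this

/-- The commutant of the shift consists of the polynomials in the shift. -/
theorem exists_aeval_shiftMat_of_commute {k : ℕ} {X : Matrix (Fin k) (Fin k) K}
    (hX : Commute X (shiftMat K k)) : ∃ f : K[X], X = aeval (shiftMat K k) f := by
  rcases k with _ | n
  · exact ⟨0, Subsingleton.elim _ _⟩
  -- The first row of N^l is the l-th unit vector, so the first row of X dictates the coefficients.
  let f : K[X] := ∑ l : Fin (n + 1), C (X 0 l) * Polynomial.X ^ (l : ℕ)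
  refine ⟨f, ?_⟩
  have hf0 : ∀ j, (aeval (shiftMat K (n + 1)) f) 0 j = X 0 j := by
    intro j
    simp only [f, map_sum, map_mul, aeval_C, map_pow, aeval_X, Matrix.sum_apply,
      ← Algebra.smul_def, Matrix.smul_apply, shiftMat_pow_apply]
    simp [← Fin.ext_iff]
  have hc : Commute (shiftMat K (n + 1)) (X - aeval (shiftMat K (n + 1)) f) :=
    Commute.sub_right hX.symm (commute_shiftMat_aeval _ f)
  rw [← sub_eq_zero]
  ext i j
  -- Row 0 of N^i D is row i of D, while row 0 of D N^i vanishes with row 0 of D. So a matrix D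
  -- commuting with N is determined by its first row.
  have h := congrFun (congrFun ((hc.pow_left (i : ℕ)).eq) 0) j
  have h0 : ∀ b, (X - aeval (shiftMat K (n + 1)) f) 0 b = 0 := by
    intro b
    rw [Matrix.sub_apply, hf0, sub_self]
  rw [Matrix.mul_apply, Matrix.mul_apply] at h
  simp only [h0, shiftMat_pow_apply] at h
  simpa [← Fin.ext_iff] using h

/-- Polynomials in N are Toeplitz, so reversing the rows gives a Hankel, hence symmetric, matrix.
This is self-adjointness with respect to E. -/
theorem aeval_shiftMat_rev {k : ℕ} (f : K[X]) (i j : Fin k) :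
    (aeval (shiftMat K k) f) i.rev j = (aeval (shiftMat K k) f) j.rev i := by
  rw [aeval_eq_sum_range, Matrix.sum_apply, Matrix.sum_apply]
  refine Finset.sum_congr rfl fun l _ => ?_
  simp only [Matrix.smul_apply, shiftMat_pow_apply, Fin.val_rev]
  congr 2
  simp only [eq_iff_iff]
  omega

theorem aeval_shiftMat_eq (k : ℕ) (f : K[X]) : ∃ g : K[X],
    aeval (shiftMat K k) f =
      algebraMap K _ (f.coeff 0) + shiftMat K k * aeval (shiftMat K k) g := by
  refine ⟨f.divX, ?_⟩
  conv_lhs => rw [← X_mul_divX_add f, map_add, map_mul, aeval_X, aeval_C, add_comm]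

theorem isNilpotent_aeval_shiftMat {k : ℕ} {f : K[X]} (hf : f.coeff 0 = 0) :
    IsNilpotent (aeval (shiftMat K k) f) := by
  obtain ⟨g, hg⟩ := aeval_shiftMat_eq k f
  rw [hg, hf, map_zero, zero_add]
  exact (commute_shiftMat_aeval k g).isNilpotent_mul_right (isNilpotent_shiftMat k)

theorem isUnit_aeval_shiftMat {k : ℕ} {f : K[X]} (hf : f.coeff 0 ≠ 0) :
    IsUnit (aeval (shiftMat K k) f) := by
  obtain ⟨g, hg⟩ := aeval_shiftMat_eq k f
  rw [hg]
  refine IsNilpotent.isUnit_add_left_of_commute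
    ((commute_shiftMat_aeval k g).isNilpotent_mul_right (isNilpotent_shiftMat k))
    ((isUnit_iff_ne_zero.mpr hf).map _) (Algebra.commutes _ _).symm

/-- Newton's method for the equation `u * r ^ 2 = e`. -/
theorem exists_mul_sq_eq_of_isNilpotent {Q : Type*} [CommRing Q] {u c e : Q}
    (h1 : IsNilpotent (u * c ^ 2 - e)) (h2 : IsUnit (2 * u * c)) : ∃ r, u * r ^ 2 = e := by
  have h3 : aeval c (C u * X ^ 2 - C e) = u * c ^ 2 - e := by simp
  have h4 : aeval c (derivative (C u * X ^ 2 - C e)) = 2 * u * c := by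
    simp
    ring
  obtain ⟨r, ⟨-, hr⟩, -⟩ :=
    existsUnique_nilpotent_sub_and_aeval_eq_zero (h3 ▸ h1) (h4 ▸ h2)
  refine ⟨r, ?_⟩
  simpa [sub_eq_zero] using hr

/-- Square roots of units of `K[X] / (X ^ k)`, as an identity for the shift. -/
theorem exists_aeval_shiftMat_mul_self_mul {k : ℕ} {f : K[X]} {c e : K} (h2 : (2 : K) ≠ 0)
    (hf : f.coeff 0 ≠ 0) (hc : c ≠ 0) (he : c ^ 2 * f.coeff 0 = e) : ∃ g : K[X],
    aeval (shiftMat K k) (g ^ 2 * f) = algebraMap K _ e := by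
  -- Newton's method needs a commutative ring, so the equation is solved modulo X^k, starting from
  -- the solution c modulo X, and then evaluated at N.
  let I : Ideal K[X] := Ideal.span {(X : K[X]) ^ k}
  let Q := K[X] ⧸ I
  let π : K[X] →+* Q := Ideal.Quotient.mk I
  have hXnil : IsNilpotent (π X) :=
    ⟨k, by rw [← map_pow]; exact Ideal.Quotient.eq_zero_iff_mem.mpr (Ideal.mem_span_singleton_self _)⟩
  have hnil : ∀ g : K[X], g.coeff 0 = 0 → IsNilpotent (π g) := by
    intro g hg
    obtain ⟨g', rfl⟩ := X_dvd_iff.mpr hg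
    rw [map_mul]
    exact (Commute.all _ _).isNilpotent_mul_right hXnil
  have hunit : ∀ g : K[X], g.coeff 0 ≠ 0 → IsUnit (π g) := by
    intro g hg
    rw [← X_mul_divX_add g, map_add, add_comm, map_mul]
    refine IsNilpotent.isUnit_add_left_of_commute
      ((Commute.all _ _).isNilpotent_mul_right hXnil)
      ((isUnit_C.mpr (isUnit_iff_ne_zero.mpr hg)).map π) (Commute.all _ _)
  have h1 : IsNilpotent (π f * π (C c) ^ 2 - π (C e)) := by
    have : π f * π (C c) ^ 2 - π (C e) = π (f * C c ^ 2 - C e) := by simp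
    rw [this]
    refine hnil _ ?_
    rw [← C_pow, coeff_sub, coeff_mul_C, coeff_C_zero, ← he]
    ring
  have h3 : IsUnit (2 * π f * π (C c)) := by
    have : 2 * π f * π (C c) = π (f * C (2 * c)) := by
      rw [C_mul, map_mul, map_mul, show (C (2 : K) : K[X]) = 2 from rfl, map_ofNat]
      ring
    rw [this]
    refine hunit _ ?_
    rw [coeff_mul_C]
    exact mul_ne_zero hf (mul_ne_zero h2 hc)
  obtain ⟨r, hr⟩ := exists_mul_sq_eq_of_isNilpotent h1 h3
  obtain ⟨g, rfl⟩ := Ideal.Quotient.mk_surjective r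
  refine ⟨g, ?_⟩
  have h4 : π (g ^ 2 * f - C e) = 0 := by
    rw [map_sub, map_mul, map_pow, ← hr, mul_comm, sub_self]
  obtain ⟨q, hq⟩ := Ideal.mem_span_singleton.mp (Ideal.Quotient.eq_zero_iff_mem.mp h4)
  rw [sub_eq_iff_eq_add.mp hq]
  simp [shiftMat_pow_self]

end ShiftMatrix
-- Commutants of single real Jordan blocks.
section Blocks

open Polynomial

theorem exchangeMat_apply (m : ℕ) (i j : Fin m) :
    exchangeMat m i j = if j = i.rev then 1 else 0 := by
  simp only [exchangeMat, Matrix.of_apply, Fin.ext_iff, Fin.val_rev]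
  congr 1
  simp only [eq_iff_iff]
  omega

theorem exchangeMat_mul_apply {m : ℕ} (X : Matrix (Fin m) (Fin m) ℝ) (i j : Fin m) :
    (exchangeMat m * X) i j = X i.rev j := by
  simp [Matrix.mul_apply, exchangeMat_apply]

theorem transpose_exchangeMat (m : ℕ) : (exchangeMat m)ᵀ = exchangeMat m := by
  ext i j
  simp only [Matrix.transpose_apply, exchangeMat, Matrix.of_apply, add_comm]

theorem mul_exchangeMat_apply {m : ℕ} (X : Matrix (Fin m) (Fin m) ℝ) (i j : Fin m) :
    (X * exchangeMat m) i j = X i j.rev := by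
  rw [← transpose_exchangeMat, ← X.transpose_transpose, ← Matrix.transpose_mul,
    Matrix.transpose_apply, exchangeMat_mul_apply, Matrix.transpose_apply]
  simp

theorem exchangeMat_mul_self (m : ℕ) : exchangeMat m * exchangeMat m = 1 := by
  ext i j
  rw [exchangeMat_mul_apply, exchangeMat_apply, Matrix.one_apply]
  simp [eq_comm]

/-- The properties of a real Jordan block `J` used for the reduction of symmetric pencils: its
commutant is local, with nilpotent maximal ideal, and consists of matrices which are
self-adjoint for the form `H`. -/
structure IsLocalBlock {n : Type*} [Fintype n] [DecidableEq n] (J H : Matrix n n ℝ) : Prop where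
  transpose_eq : Hᵀ = H
  mul_self : H * H = 1
  mul_eq : ∀ X, Commute X J → H * X = Xᵀ * H
  isUnit_or_isNilpotent : ∀ X, Commute X J → IsUnit X ∨ IsNilpotent X

/-- A product of self-adjoint elements that is itself self-adjoint equals the product in the
opposite order. -/
theorem IsLocalBlock.commute {n : Type*} [Fintype n] [DecidableEq n] {J H : Matrix n n ℝ}
    (h : IsLocalBlock J H) {X Y : Matrix n n ℝ} (hX : Commute X J) (hY : Commute Y J) :
    Commute X Y := by
  have h1 := h.mul_eq _ (hX.mul_left hY)
  rw [Matrix.transpose_mul, mul_assoc Yᵀ, ← h.mul_eq _ hX, ← mul_assoc Yᵀ, ← h.mul_eq _ hY,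
    mul_assoc] at h1
  have h2 := congrArg (H * ·) h1
  simp only [← mul_assoc, h.mul_self, one_mul] at h2
  exact h2

theorem aeval_shiftMat_isUnit_or_isNilpotent {K : Type*} [Field K] {k : ℕ} (f : K[X]) :
    IsUnit (aeval (shiftMat K k) f) ∨ IsNilpotent (aeval (shiftMat K k) f) := by
  by_cases hf : f.coeff 0 = 0
  · exact Or.inr (isNilpotent_aeval_shiftMat hf)
  · exact Or.inl (isUnit_aeval_shiftMat hf)

theorem realEigJordanBlock_eq (c : ℝ) (m : ℕ) :
    realEigJordanBlock c m = algebraMap ℝ _ c + shiftMat ℝ m := by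
  ext i j
  simp only [realEigJordanBlock, Matrix.of_apply, Matrix.add_apply, Matrix.algebraMap_matrix_apply,
    shiftMat_apply]
  by_cases h : i = j
  · simp [h]
  · simp [h]

theorem commute_realEigJordanBlock_iff {c : ℝ} {m : ℕ} {X : Matrix (Fin m) (Fin m) ℝ} :
    Commute X (realEigJordanBlock c m) ↔ Commute X (shiftMat ℝ m) := by
  rw [realEigJordanBlock_eq]
  have h : Commute X (algebraMap ℝ (Matrix (Fin m) (Fin m) ℝ) c) := Algebra.commutes' c X |>.symm
  exact ⟨fun h' => by simpa using h'.sub_right h, fun h' => h.add_right h'⟩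

theorem isLocalBlock_realEigJordanBlock (c : ℝ) (m : ℕ) :
    IsLocalBlock (realEigJordanBlock c m) (exchangeMat m) where
  transpose_eq := transpose_exchangeMat m
  mul_self := exchangeMat_mul_self m
  mul_eq X hX := by
    obtain ⟨f, rfl⟩ := exists_aeval_shiftMat_of_commute (commute_realEigJordanBlock_iff.mp hX)
    ext i j
    rw [exchangeMat_mul_apply, mul_exchangeMat_apply, Matrix.transpose_apply, aeval_shiftMat_rev]
  isUnit_or_isNilpotent X hX := by
    obtain ⟨f, rfl⟩ := exists_aeval_shiftMat_of_commute (commute_realEigJordanBlock_iff.mp hX)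
    exact aeval_shiftMat_isUnit_or_isNilpotent f

theorem coeff_zero_ne_zero_of_isUnit {K : Type*} [Field K] {k : ℕ} (hk : 0 < k) {f : K[X]}
    (hu : IsUnit (aeval (shiftMat K k) f)) : f.coeff 0 ≠ 0 := by
  intro hf
  have : Nonempty (Fin k) := ⟨⟨0, hk⟩⟩
  exact (isNilpotent_aeval_shiftMat (k := k) hf).not_isUnit hu

/-- Polynomials in N commute, so this two-sided product is g²f and a square root suffices. The
nonzero value e makes g(N) a unit. -/
theorem exists_aeval_shiftMat_conj {K : Type*} [Field K] {k : ℕ} {f : K[X]} {c e : K}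
    (h2 : (2 : K) ≠ 0) (he0 : e ≠ 0) (he : c ^ 2 * f.coeff 0 = e) : ∃ g : K[X],
    IsUnit (aeval (shiftMat K k) g) ∧
    aeval (shiftMat K k) g * aeval (shiftMat K k) f * aeval (shiftMat K k) g =
      algebraMap K _ e := by
  have hf : f.coeff 0 ≠ 0 := by
    rintro h
    simp [h, he0.symm] at he
  have hc : c ≠ 0 := by
    rintro rfl
    simp [he0.symm] at he
  obtain ⟨g, hg⟩ := exists_aeval_shiftMat_mul_self_mul (k := k) h2 hf hc he
  have h1 : aeval (shiftMat K k) g * aeval (shiftMat K k) f * aeval (shiftMat K k) g =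
      algebraMap K _ e := by
    rw [← hg, ← map_mul, ← map_mul]
    congr 1
    ring
  refine ⟨g, ?_, h1⟩
  have h3 : IsUnit (aeval (shiftMat K k) g * aeval (shiftMat K k) (f * g)) := by
    rw [map_mul, ← mul_assoc, h1]
    exact (isUnit_iff_ne_zero.mpr he0).map _
  rw [← map_mul, mul_comm, map_mul, Matrix.isUnit_iff_isUnit_det, Matrix.det_mul] at h3
  exact (Matrix.isUnit_iff_isUnit_det _).mpr (isUnit_of_mul_isUnit_right h3)

theorem commute_aeval_realEigJordanBlock {c : ℝ} {m : ℕ} (g : ℝ[X]) :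
    Commute (aeval (shiftMat ℝ m) g) (realEigJordanBlock c m) :=
  commute_realEigJordanBlock_iff.mpr (commute_shiftMat_aeval m g).symm

/-- A unit of the commutant of a real Jordan block is a square up to sign. -/
theorem exists_conj_eq_sign_of_commute_realEigJordanBlock {c : ℝ} {m : ℕ} (hm : 0 < m)
    {X : Matrix (Fin m) (Fin m) ℝ} (hX : Commute X (realEigJordanBlock c m)) (hu : IsUnit X) :
    ∃ (σ : ℝ) (Q : Matrix (Fin m) (Fin m) ℝ), (σ = 1 ∨ σ = -1) ∧ IsUnit Q ∧
      Commute Q (realEigJordanBlock c m) ∧ Q * X * Q = σ • 1 := by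
  obtain ⟨f, rfl⟩ := exists_aeval_shiftMat_of_commute (commute_realEigJordanBlock_iff.mp hX)
  have hf := coeff_zero_ne_zero_of_isUnit hm hu
  -- Over ℝ the constant term can be rescaled by positive squares only, so its sign survives as σ.
  obtain ⟨σ, hσ, hσf⟩ : ∃ σ : ℝ, (σ = 1 ∨ σ = -1) ∧ (√|f.coeff 0|)⁻¹ ^ 2 * f.coeff 0 = σ := by
    refine ⟨_, ?_, rfl⟩
    rw [inv_pow, Real.sq_sqrt (abs_nonneg _)]
    rcases abs_choice (f.coeff 0) with h | h <;> rw [h]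
    · exact Or.inl (inv_mul_cancel₀ hf)
    · right
      field_simp
  have hσ0 : σ ≠ 0 := by rcases hσ with rfl | rfl <;> norm_num
  obtain ⟨g, hg, h⟩ := exists_aeval_shiftMat_conj (k := m) two_ne_zero hσ0 hσf
  exact ⟨σ, _, hσ, hg, commute_aeval_realEigJordanBlock g, by rw [h, Algebra.algebraMap_eq_smul_one]⟩

/-- Complex matrices of size `k` as real matrices of size `2 * k`. -/
noncomputable def realify (k : ℕ) :
    Matrix (Fin k) (Fin k) ℂ →+* Matrix (Fin (k * 2)) (Fin (k * 2)) ℝ :=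
  (Matrix.reindexRingEquiv ℝ finProdFinEquiv).toRingHom.comp
    ((Matrix.compRingEquiv (Fin k) (Fin 2) ℝ).toRingHom.comp
      (Algebra.leftMulMatrix Complex.basisOneI).toRingHom.mapMatrix)

theorem realify_apply {k : ℕ} (X : Matrix (Fin k) (Fin k) ℂ) (i j : Fin k) (a b : Fin 2) :
    realify k X (finProdFinEquiv (i, a)) (finProdFinEquiv (j, b)) =
      !![(X i j).re, -(X i j).im; (X i j).im, (X i j).re] a b := by
  rw [← Algebra.leftMulMatrix_complex]
  simp [realify]

theorem ext_prod {k : ℕ} {X Y : Matrix (Fin (k * 2)) (Fin (k * 2)) ℝ}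
    (h : ∀ (i j : Fin k) (a b : Fin 2), X (finProdFinEquiv (i, a)) (finProdFinEquiv (j, b)) =
      Y (finProdFinEquiv (i, a)) (finProdFinEquiv (j, b))) : X = Y := by
  ext i j
  obtain ⟨⟨i, a⟩, rfl⟩ := finProdFinEquiv.surjective i
  obtain ⟨⟨j, b⟩, rfl⟩ := finProdFinEquiv.surjective j
  exact h i j a b

theorem realify_injective (k : ℕ) : Function.Injective (realify k) := by
  intro X Y h
  ext i j
  have h0 := congrFun (congrFun h (finProdFinEquiv (i, 0))) (finProdFinEquiv (j, 0))
  have h1 := congrFun (congrFun h (finProdFinEquiv (i, 1))) (finProdFinEquiv (j, 0))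
  rw [realify_apply, realify_apply] at h0 h1
  exact Complex.ext (by simpa using h0) (by simpa using h1)

theorem complexEigJordanBlock_eq (z : ℂ) (k : ℕ) :
    complexEigJordanBlock z.re z.im (k * 2) =
      realify k (algebraMap ℂ _ z + shiftMat ℂ k) := by
  refine ext_prod fun i j a b => ?_
  rw [realify_apply]
  simp only [complexEigJordanBlock, Matrix.of_apply, finProdFinEquiv_apply_val, Matrix.add_apply,
    Matrix.algebraMap_matrix_apply, shiftMat_apply, Fin.lt_def, Fin.ext_iff]
  rcases eq_or_ne i j with rfl | hij
  · fin_cases a <;> fin_cases b <;> simp <;> split_ifs <;> first | rfl | omega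
  · have hij' : (i : ℕ) ≠ j := fun h => hij (Fin.ext h)
    by_cases hj : (j : ℕ) = i + 1
    · fin_cases a <;> fin_cases b <;> simp [hj] <;> (try split_ifs) <;>
        first | rfl | omega
    · fin_cases a <;> fin_cases b <;> simp [hj] <;> (try split_ifs) <;>
        first | rfl | omega | simp

/-- Commuting with multiplication by i is ℂ-linearity; each complex entry is read off the first
column of its 2 × 2 block. -/
theorem exists_realify_eq_of_commute {k : ℕ} {X : Matrix (Fin (k * 2)) (Fin (k * 2)) ℝ}
    (hX : Commute X (realify k (algebraMap ℂ _ Complex.I))) : ∃ Y, X = realify k Y := by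
  refine ⟨Matrix.of fun i j => ⟨X (finProdFinEquiv (i, 0)) (finProdFinEquiv (j, 0)),
    X (finProdFinEquiv (i, 1)) (finProdFinEquiv (j, 0))⟩, ext_prod fun i j a b => ?_⟩
  have h : ∀ a b, ∑ c, X (finProdFinEquiv (i, a)) (finProdFinEquiv (j, c)) *
      (!![0, -1; 1, 0] : Matrix (Fin 2) (Fin 2) ℝ) c b =
      ∑ c, (!![0, -1; 1, 0] : Matrix (Fin 2) (Fin 2) ℝ) a c *
        X (finProdFinEquiv (i, c)) (finProdFinEquiv (j, b)) := by
    intro a b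
    have h := congrFun (congrFun hX.eq (finProdFinEquiv (i, a))) (finProdFinEquiv (j, b))
    rw [Matrix.mul_apply, Matrix.mul_apply, ← finProdFinEquiv.sum_comp,
      ← finProdFinEquiv.sum_comp, Fintype.sum_prod_type, Fintype.sum_prod_type,
      Finset.sum_eq_single j, Finset.sum_eq_single i] at h
    · simpa [realify_apply, Matrix.algebraMap_matrix_apply] using h
    · intro l _ hl
      refine Finset.sum_eq_zero fun c _ => ?_
      rw [realify_apply, Matrix.algebraMap_matrix_apply, if_neg hl.symm]
      fin_cases a <;> fin_cases c <;> simp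
    · simp
    · intro l _ hl
      refine Finset.sum_eq_zero fun c _ => ?_
      rw [realify_apply, Matrix.algebraMap_matrix_apply, if_neg hl]
      fin_cases b <;> fin_cases c <;> simp
    · simp
  have h00 := h 0 0
  have h10 := h 1 0
  rw [realify_apply]
  simp at h00 h10
  fin_cases a <;> fin_cases b <;> simp <;> linarith

/-- On x, f acts as -n/b, so high powers of f kill x. But the relation f³ = -4f makes every odd
power of f a nonzero multiple of f, so f x = 0. -/
theorem commute_of_smul_add_of_pow_three {E : Type*} [AddCommGroup E] [Module ℝ E]
    {f n : Module.End ℝ E} {b : ℝ} (hb : b ≠ 0) (hfn : Commute f n) (hn : IsNilpotent n)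
    (hf : f ^ 3 = (-4 : ℝ) • f) {x : E} (hx : b • f x + n x = 0) : f x = 0 := by
  obtain ⟨K, hK⟩ := hn
  have h1 : ∀ j, b ^ j • (f ^ j) x = (-1 : ℝ) ^ j • (n ^ j) x := by
    intro j
    induction j with
    | zero => simp
    | succ j ih =>
      have h2 : (f ^ (j + 1)) x = f ((f ^ j) x) := by rw [pow_succ']; rfl
      have h3 : (n ^ (j + 1)) x = (n ^ j) (n x) := by rw [pow_succ]; rfl
      have h4 : f ((n ^ j) x) = (n ^ j) (f x) :=
        LinearMap.congr_fun (hfn.pow_right j).eq x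
      have h5 : n x = (-b) • f x := by
        rw [neg_smul]
        exact eq_neg_of_add_eq_zero_right hx
      rw [h2, h3, h5, pow_succ', mul_smul, ← map_smul, ih, map_smul, h4, map_smul, pow_succ]
      module
  have h6 : ∀ j, (f ^ (2 * j + 1)) x = (-4 : ℝ) ^ j • f x := by
    intro j
    induction j with
    | zero => simp
    | succ j ih =>
      have : f ^ (2 * (j + 1) + 1) = (-4 : ℝ) • f ^ (2 * j + 1) := by
        rw [show 2 * (j + 1) + 1 = 3 + 2 * j by ring, pow_add, hf, smul_mul_assoc, ← pow_succ']
      rw [this, LinearMap.smul_apply, ih, smul_smul, pow_succ']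
  have h7 := h1 (2 * K + 1)
  have h8 : n ^ (2 * K + 1) = 0 := by
    rw [show 2 * K + 1 = K + (K + 1) by ring, pow_add, hK, zero_mul]
  rw [h8, h6, LinearMap.zero_apply, smul_zero, smul_smul] at h7
  exact (smul_eq_zero.mp h7).resolve_left (mul_ne_zero (pow_ne_zero _ hb) (pow_ne_zero _ (by norm_num)))

/-- If `a + b i + n` commutes with `x`, where `i ^ 2 = -1`, `b ≠ 0` and `n` is nilpotent and
commutes with `i`, then `i` commutes with `x`. -/
theorem commute_of_commute_smul_add_nilpotent {R : Type*} [Ring R] [Algebra ℝ R] {i n x : R}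
    {b : ℝ} (hb : b ≠ 0) (hi : i * i = -1) (hn : IsNilpotent n) (hin : Commute i n)
    (hx : Commute x (b • i + n)) : Commute x i := by
  -- Apply this to the commutators f = [i, ·] and n = [n, ·]. Since i² = -1, left and right
  -- multiplication by i give f³ = -4f.
  have h0 := commute_of_smul_add_of_pow_three (E := R)
    (f := LinearMap.mulLeft ℝ i - LinearMap.mulRight ℝ i)
    (n := LinearMap.mulLeft ℝ n - LinearMap.mulRight ℝ n) (x := x) hb ?_
    ((LinearMap.commute_mulLeft_right (R := ℝ) n n).isNilpotent_sub
      ((LinearMap.isNilpotent_mulLeft_iff ℝ n).mpr hn)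
      ((LinearMap.isNilpotent_mulRight_iff ℝ n).mpr hn)) ?_ ?_
  · rw [LinearMap.sub_apply, LinearMap.mulLeft_apply, LinearMap.mulRight_apply, sub_eq_zero] at h0
    exact h0.symm
  · refine LinearMap.ext fun y => ?_
    simp only [Module.End.mul_apply, LinearMap.sub_apply, LinearMap.mulLeft_apply,
      LinearMap.mulRight_apply, mul_sub, sub_mul]
    rw [← mul_assoc i n, ← mul_assoc n i, mul_assoc y n i, mul_assoc y i n, hin.eq]
    simp only [mul_assoc]
    abel
  · refine LinearMap.ext fun y => ?_
    have h1 : ∀ w, i * (i * w) = -w := fun w => by rw [← mul_assoc, hi, neg_one_mul]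
    simp only [pow_succ, pow_zero, one_mul, Module.End.mul_apply, LinearMap.sub_apply,
      LinearMap.mulLeft_apply, LinearMap.mulRight_apply, LinearMap.smul_apply, mul_sub, sub_mul,
      mul_assoc, h1, hi, mul_neg, neg_mul, mul_one]
    module
  · have h1 := hx.eq
    simp only [LinearMap.sub_apply, LinearMap.mulLeft_apply, LinearMap.mulRight_apply]
    rw [mul_add, add_mul, mul_smul_comm, smul_mul_assoc] at h1
    rw [smul_sub, sub_add_sub_comm, ← h1, sub_self]

theorem exists_realify_aeval_of_commute {z : ℂ} (hz : z.im ≠ 0) {k : ℕ}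
    {X : Matrix (Fin (k * 2)) (Fin (k * 2)) ℝ}
    (hX : Commute X (complexEigJordanBlock z.re z.im (k * 2))) :
    ∃ f : ℂ[X], X = realify k (aeval (shiftMat ℂ k) f) := by
  have hJ : complexEigJordanBlock z.re z.im (k * 2) = z.re • 1 +
      (z.im • realify k (algebraMap ℂ _ Complex.I) + realify k (shiftMat ℂ k)) := by
    rw [complexEigJordanBlock_eq, map_add, ← add_assoc]
    congr 1
    rw [← map_one (realify k)]
    refine ext_prod fun i j a b => ?_
    simp only [Matrix.add_apply, Matrix.smul_apply, realify_apply, Matrix.algebraMap_matrix_apply,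
      Matrix.one_apply]
    split_ifs <;> fin_cases a <;> fin_cases b <;> simp
  rw [hJ] at hX
  have hX' : Commute X (z.im • realify k (algebraMap ℂ _ Complex.I) + realify k (shiftMat ℂ k)) := by
    have h1 : Commute X (z.re • 1) := (Commute.one_right X).smul_right _
    simpa using hX.sub_right h1
  have hI := commute_of_commute_smul_add_nilpotent hz
    (by rw [← map_mul, ← map_mul, Complex.I_mul_I, map_neg, map_neg, map_one, map_one])
    ((isNilpotent_shiftMat k).map (realify k))
    ((Algebra.commute_algebraMap_left Complex.I (shiftMat ℂ k)).map (realify k)) hX'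
  have hN : Commute X (realify k (shiftMat ℂ k)) := by
    simpa using hX'.sub_right (hI.smul_right z.im)
  obtain ⟨Y, rfl⟩ := exists_realify_eq_of_commute hI
  have hY : Commute Y (shiftMat ℂ k) := by
    refine realify_injective k ?_
    rw [map_mul, map_mul]
    exact hN.eq
  obtain ⟨f, rfl⟩ := exists_aeval_shiftMat_of_commute hY
  exact ⟨f, rfl⟩

theorem rev_finProdFinEquiv {k : ℕ} (i : Fin k) (a : Fin 2) :
    (finProdFinEquiv (i, a)).rev = finProdFinEquiv (i.rev, a.rev) := by
  ext
  simp only [Fin.val_rev, finProdFinEquiv_apply_val]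
  omega

theorem isLocalBlock_complexEigJordanBlock {z : ℂ} (hz : z.im ≠ 0) (k : ℕ) :
    IsLocalBlock (complexEigJordanBlock z.re z.im (k * 2)) (exchangeMat (k * 2)) where
  transpose_eq := transpose_exchangeMat _
  mul_self := exchangeMat_mul_self _
  mul_eq X hX := by
    obtain ⟨f, rfl⟩ := exists_realify_aeval_of_commute hz hX
    refine ext_prod fun i j a b => ?_
    rw [exchangeMat_mul_apply, mul_exchangeMat_apply, Matrix.transpose_apply, rev_finProdFinEquiv,
      rev_finProdFinEquiv, realify_apply, realify_apply, aeval_shiftMat_rev]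
    fin_cases a <;> fin_cases b <;> rfl
  isUnit_or_isNilpotent X hX := by
    obtain ⟨f, rfl⟩ := exists_realify_aeval_of_commute hz hX
    exact (aeval_shiftMat_isUnit_or_isNilpotent f).imp (fun h => h.map _) (fun h => h.map _)

/-- A unit of the commutant of a real Jordan block with non-real eigenvalues is a square. -/
theorem exists_conj_eq_one_of_commute_complexEigJordanBlock {z : ℂ} (hz : z.im ≠ 0) {k : ℕ}
    (hk : 0 < k) {X : Matrix (Fin (k * 2)) (Fin (k * 2)) ℝ}
    (hX : Commute X (complexEigJordanBlock z.re z.im (k * 2))) (hu : IsUnit X) :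
    ∃ Q : Matrix (Fin (k * 2)) (Fin (k * 2)) ℝ, IsUnit Q ∧
      Commute Q (complexEigJordanBlock z.re z.im (k * 2)) ∧ Q * X * Q = 1 := by
  obtain ⟨f, rfl⟩ := exists_realify_aeval_of_commute hz hX
  have hf : f.coeff 0 ≠ 0 := by
    intro hf
    have : Nonempty (Fin (k * 2)) := ⟨⟨0, by omega⟩⟩
    exact ((isNilpotent_aeval_shiftMat (k := k) hf).map (realify k)).not_isUnit hu
  -- Every complex number has a square root, so no sign remains.
  obtain ⟨c, hc⟩ := IsAlgClosed.exists_pow_nat_eq (f.coeff 0)⁻¹ two_pos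
  obtain ⟨g, hg, h⟩ := exists_aeval_shiftMat_conj (k := k) (e := 1) (two_ne_zero' ℂ) one_ne_zero
    (by rw [hc, inv_mul_cancel₀ hf])
  refine ⟨realify k (aeval (shiftMat ℂ k) g), hg.map _, ?_, ?_⟩
  · rw [complexEigJordanBlock_eq]
    exact Commute.map ((Algebra.commute_algebraMap_right z _).add_right
        (commute_shiftMat_aeval k g).symm) (realify k)
  · rw [← map_mul, ← map_mul, h, map_one, map_one]

end Blocks
-- Block Gram–Schmidt by congruences commuting with J.
section Orthogonalization

open Matrix

/-- The relation AJ = JᵀA survives the allowed congruences, so they can be iterated. -/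
theorem intertwine_congr {n : Type*} [Fintype n] {A P J : Matrix n n ℝ}
    (hAJ : A * J = Jᵀ * A) (hP : Commute P J) :
    Pᵀ * A * P * J = Jᵀ * (Pᵀ * A * P) := by
  have h := congrArg transpose hP.eq
  rw [transpose_mul, transpose_mul] at h
  rw [mul_assoc, hP.eq, ← mul_assoc, mul_assoc Pᵀ, hAJ, ← mul_assoc, ← h]
  simp only [mul_assoc]

variable {ι : Type*} [Fintype ι] [DecidableEq ι] {d : ι → ℕ}

/-- The inclusion of the `s`-th block of coordinates, as a matrix. -/
def blockIncl (d : ι → ℕ) (s : ι) : Matrix (Σ s, Fin (d s)) (Fin (d s)) ℝ :=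
  (1 : Matrix (Σ s, Fin (d s)) (Σ s, Fin (d s)) ℝ).submatrix id fun i => ⟨s, i⟩

theorem mul_blockIncl {α : Type*} (M : Matrix α (Σ s, Fin (d s)) ℝ) (s : ι) :
    M * blockIncl d s = M.submatrix id fun i => ⟨s, i⟩ := by
  ext i j
  simp [blockIncl, Matrix.mul_apply, Matrix.one_apply]

theorem blockIncl_transpose_mul {α : Type*} (M : Matrix (Σ s, Fin (d s)) α ℝ) (s : ι) :
    (blockIncl d s)ᵀ * M = M.submatrix (fun i => ⟨s, i⟩) id := by
  rw [← M.transpose_transpose, ← transpose_mul, mul_blockIncl]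
  rfl

theorem blockIncl_transpose_mul_self (s : ι) : (blockIncl d s)ᵀ * blockIncl d s = 1 := by
  rw [blockIncl_transpose_mul]
  ext i j
  simp [blockIncl, Matrix.one_apply]

theorem blockIncl_transpose_mul_of_ne {s t : ι} (h : s ≠ t) :
    (blockIncl d s)ᵀ * blockIncl d t = 0 := by
  rw [blockIncl_transpose_mul]
  ext i j
  simp [blockIncl, h]

theorem sum_blockIncl_mul_transpose : ∑ s, blockIncl d s * (blockIncl d s)ᵀ = 1 := by
  ext ⟨s, i⟩ ⟨t, j⟩
  rw [Matrix.sum_apply, Finset.sum_eq_single s]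
  · rw [mul_apply, Finset.sum_eq_single i]
    · simp only [blockIncl, Matrix.transpose_apply, submatrix_apply, Matrix.one_apply, id, if_true,
        one_mul]
      exact if_congr eq_comm rfl rfl
    · intro b _ hb
      simp [blockIncl, Matrix.one_apply, hb.symm]
    · simp
  · intro u _ hu
    rw [mul_apply]
    refine Finset.sum_eq_zero fun b _ => ?_
    simp [blockIncl, Matrix.one_apply, hu.symm]
  · simp

theorem blockDiagonal'_mul_blockIncl (X : ∀ s, Matrix (Fin (d s)) (Fin (d s)) ℝ) (s : ι) :
    blockDiagonal' X * blockIncl d s = blockIncl d s * X s := by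
  rw [mul_blockIncl]
  ext ⟨t, i⟩ j
  rw [mul_apply]
  rcases eq_or_ne t s with rfl | h
  · simp [blockIncl, Matrix.one_apply]
  · simp [blockIncl, h, blockDiagonal'_apply_ne]

theorem blockIncl_transpose_mul_blockDiagonal' (X : ∀ s, Matrix (Fin (d s)) (Fin (d s)) ℝ) (s : ι) :
    (blockIncl d s)ᵀ * blockDiagonal' X = X s * (blockIncl d s)ᵀ := by
  have := congrArg transpose (blockDiagonal'_mul_blockIncl (fun s => (X s)ᵀ) s)
  simpa [transpose_mul, blockDiagonal'_transpose] using this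

/-- The `(s, t)` block of a matrix. -/
def blk (A : Matrix (Σ s, Fin (d s)) (Σ s, Fin (d s)) ℝ) (s t : ι) :
    Matrix (Fin (d s)) (Fin (d t)) ℝ :=
  (blockIncl d s)ᵀ * A * blockIncl d t

variable {A P : Matrix (Σ s, Fin (d s)) (Σ s, Fin (d s)) ℝ}

theorem transpose_blk (A : Matrix (Σ s, Fin (d s)) (Σ s, Fin (d s)) ℝ) (s t : ι) :
    (blk A s t)ᵀ = blk Aᵀ t s := by
  simp [blk, Matrix.mul_assoc]

theorem blk_mul (A B : Matrix (Σ s, Fin (d s)) (Σ s, Fin (d s)) ℝ) (s t : ι) :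
    blk (A * B) s t = ∑ u, blk A s u * blk B u t := by
  have : A * B = A * (∑ u, blockIncl d u * (blockIncl d u)ᵀ) * B := by
    rw [sum_blockIncl_mul_transpose, Matrix.mul_one]
  rw [blk, this]
  simp only [blk, Matrix.mul_sum, Matrix.sum_mul, Matrix.mul_assoc]

theorem blk_one_self (s : ι) : blk (1 : Matrix (Σ s, Fin (d s)) _ ℝ) s s = 1 := by
  rw [blk, Matrix.mul_one, blockIncl_transpose_mul_self]

theorem blk_eq_submatrix (A : Matrix (Σ s, Fin (d s)) (Σ s, Fin (d s)) ℝ) (s t : ι) :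
    blk A s t = A.submatrix (fun i => ⟨s, i⟩) fun j => ⟨t, j⟩ := by
  rw [blk, mul_blockIncl, blockIncl_transpose_mul]
  rfl

theorem eq_blockDiagonal'_of_blk (h : ∀ s t, t ≠ s → blk A s t = 0) :
    A = blockDiagonal' fun s => blk A s s := by
  ext ⟨s, i⟩ ⟨t, j⟩
  rcases eq_or_ne t s with rfl | hst
  · rw [blockDiagonal'_apply_eq, blk_eq_submatrix]
    rfl
  · rw [blockDiagonal'_apply_ne _ _ _ hst.symm]
    have := congrFun (congrFun (h s t hst) i) j
    rwa [blk_eq_submatrix] at this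

theorem blk_mul_of_intertwine {X Y : ∀ s, Matrix (Fin (d s)) (Fin (d s)) ℝ}
    (h : A * blockDiagonal' X = blockDiagonal' Y * A) (s t : ι) :
    blk A s t * X t = Y s * blk A s t := by
  rw [blk, Matrix.mul_assoc, ← blockDiagonal'_mul_blockIncl, ← Matrix.mul_assoc,
    Matrix.mul_assoc _ A, h, ← Matrix.mul_assoc, blockIncl_transpose_mul_blockDiagonal']
  simp only [Matrix.mul_assoc]

variable {J H : ∀ s, Matrix (Fin (d s)) (Fin (d s)) ℝ}

theorem IsLocalBlock.mul_transpose {n : Type*} [Fintype n] [DecidableEq n] {J H : Matrix n n ℝ}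
    (h : IsLocalBlock J H) : H * Jᵀ = J * H := by
  have h1 := h.mul_eq J (Commute.refl J)
  calc H * Jᵀ = H * (Jᵀ * H) * H := by rw [Matrix.mul_assoc, Matrix.mul_assoc, h.mul_self, Matrix.mul_one]
    _ = J * H := by rw [← h1, ← Matrix.mul_assoc, h.mul_self, Matrix.one_mul]

/-- Multiplication by H turns a form for which J is self-adjoint into an element of the local
commutant. -/
theorem IsLocalBlock.commute_mul {n : Type*} [Fintype n] [DecidableEq n] {J H : Matrix n n ℝ}
    (h : IsLocalBlock J H) {Y : Matrix n n ℝ} (hY : Y * J = Jᵀ * Y) : Commute (H * Y) J := by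
  rw [Commute, SemiconjBy, mul_assoc, hY, ← mul_assoc, h.mul_transpose, mul_assoc]

theorem IsLocalBlock.isUnit {n : Type*} [Fintype n] [DecidableEq n] {J H : Matrix n n ℝ}
    (h : IsLocalBlock J H) : IsUnit H :=
  IsUnit.of_mul_eq_one _ h.mul_self

theorem isUnit_one_add_of_mul_self {R : Type*} [Ring R] {K : R} (h : K * K = 0) : IsUnit (1 + K) :=
  IsNilpotent.isUnit_one_add ⟨2, by rw [pow_two, h]⟩

theorem blk_congr (A P : Matrix (Σ s, Fin (d s)) (Σ s, Fin (d s)) ℝ) (s t : ι) :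
    blk (Pᵀ * A * P) s t = (P * blockIncl d s)ᵀ * A * (P * blockIncl d t) := by
  simp only [blk, transpose_mul, Matrix.mul_assoc]

theorem transpose_mul_mul_eq_blk (A : Matrix (Σ s, Fin (d s)) (Σ s, Fin (d s)) ℝ) (s t : ι) :
    (blockIncl d s)ᵀ * (A * blockIncl d t) = blk A s t := by
  rw [blk, Matrix.mul_assoc]

/-- A nonsingular diagonal block splits off as an orthogonal summand. -/
theorem exists_congr_split_block {U : Finset ι} {s : ι} (hJ : IsLocalBlock (J s) (H s))
    (hA : Aᵀ = A) (hAJ : A * blockDiagonal' J = (blockDiagonal' J)ᵀ * A)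
    (hU : ∀ u ∈ U, ∀ t, t ≠ u → blk A u t = 0) (hs : IsUnit (blk A s s)) :
    ∃ P, IsUnit P ∧ Commute P (blockDiagonal' J) ∧
      ∀ u ∈ insert s U, ∀ t, t ≠ u → blk (Pᵀ * A * P) u t = 0 := by
  obtain ⟨a, ha1, ha2⟩ := isUnit_iff_exists.mp hs
  set e := blockIncl d s with he
  have hee : eᵀ * e = 1 := blockIncl_transpose_mul_self s
  have hAJ' := hAJ
  rw [blockDiagonal'_transpose] at hAJ'
  have hss := blk_mul_of_intertwine hAJ' s s
  have haJ : a * (J s)ᵀ = J s * a := by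
    calc a * (J s)ᵀ = a * ((J s)ᵀ * blk A s s) * a := by
          rw [Matrix.mul_assoc, Matrix.mul_assoc, ha1, Matrix.mul_one]
      _ = J s * a := by rw [← hss, ← Matrix.mul_assoc, ha2, Matrix.one_mul]
  -- Block elimination with pivot A_ss: 1 + K fixes the s-th block of columns and subtracts a
  -- multiple of it from each other block t, chosen to clear A_st.
  let K := e * (a * (blk A s s * eᵀ - eᵀ * A))
  have hKe : K * e = 0 := by
    simp only [K, Matrix.mul_assoc, Matrix.sub_mul, hee, Matrix.mul_one]
    rw [transpose_mul_mul_eq_blk, sub_self, Matrix.mul_zero, Matrix.mul_zero]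
  have hKt : ∀ t, t ≠ s → K * blockIncl d t = - (e * (a * blk A s t)) := by
    intro t ht
    simp only [K, Matrix.mul_assoc, Matrix.sub_mul, he, blockIncl_transpose_mul_of_ne ht.symm,
      Matrix.mul_zero, zero_sub, Matrix.mul_neg]
    rw [transpose_mul_mul_eq_blk]
  have hKK : K * K = 0 := by
    conv_lhs => rhs; rw [show K = e * (a * (blk A s s * eᵀ - eᵀ * A)) from rfl]
    rw [← Matrix.mul_assoc, hKe, Matrix.zero_mul]
  have hPe : (1 + K) * e = e := by rw [Matrix.add_mul, hKe, Matrix.one_mul, add_zero]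
  have hPt : ∀ t, t ≠ s → (1 + K) * blockIncl d t = blockIncl d t - e * (a * blk A s t) := by
    intro t ht
    rw [Matrix.add_mul, hKt t ht, Matrix.one_mul, sub_eq_add_neg]
  have hst : ∀ u, ∀ t, t ≠ s → (blockIncl d u)ᵀ * A * ((1 + K) * blockIncl d t) =
      blk A u t - blk A u s * (a * blk A s t) := by
    intro u t ht
    rw [hPt t ht, Matrix.mul_sub, ← Matrix.mul_assoc _ e]
    rfl
  refine ⟨1 + K, isUnit_one_add_of_mul_self hKK, ?_, ?_⟩
  · refine (Commute.one_left _).add_left ?_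
    have h1 : eᵀ * blockDiagonal' J = J s * eᵀ := blockIncl_transpose_mul_blockDiagonal' J s
    have h2 : blockDiagonal' J * e = e * J s := blockDiagonal'_mul_blockIncl J s
    have h3 : eᵀ * (blockDiagonal' J)ᵀ = (J s)ᵀ * eᵀ := by
      rw [← transpose_mul, h2, transpose_mul]
    have h4 : (blk A s s * eᵀ - eᵀ * A) * blockDiagonal' J =
        (J s)ᵀ * (blk A s s * eᵀ - eᵀ * A) := by
      rw [Matrix.sub_mul, Matrix.mul_sub, Matrix.mul_assoc, h1, ← Matrix.mul_assoc, hss,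
        Matrix.mul_assoc eᵀ, hAJ, ← Matrix.mul_assoc eᵀ, h3]
      simp only [Matrix.mul_assoc]
    change K * _ = _ * K
    simp only [K]
    rw [Matrix.mul_assoc, Matrix.mul_assoc, h4, ← Matrix.mul_assoc a, haJ, ← Matrix.mul_assoc _ e,
      h2]
    simp only [Matrix.mul_assoc]
  · intro u hu t ht
    rw [blk_congr]
    rcases eq_or_ne u s with rfl | hus
    · rw [hPe, hst _ t ht, ← Matrix.mul_assoc, ha1, Matrix.one_mul, sub_self]
    · have huU : u ∈ U := (Finset.mem_insert.mp hu).resolve_left hus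
      -- Blocks already split off are orthogonal to s, so the elimination does not touch them.
      have hsu : blk A s u = 0 := by
        rw [← hA, ← transpose_blk, hU u huU s hus.symm, transpose_zero]
      rw [hPt u hus, hsu, Matrix.mul_zero, Matrix.mul_zero, sub_zero]
      rcases eq_or_ne t s with rfl | hts
      · rw [hPe]
        exact hU u huU _ ht
      · rw [hst u t hts, hU u huU t ht, hU u huU s hus.symm, Matrix.zero_mul, sub_zero]

/-- Some block of a nonsingular self-adjoint matrix, outside of the part that is already split
off, is nonsingular. -/
theorem exists_left_inverse_blk {U : Finset ι} {s : ι} (hJ : IsLocalBlock (J s) (H s))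
    (hs : 0 < d s) (hu : IsUnit A) (hAJ : A * blockDiagonal' J = (blockDiagonal' J)ᵀ * A)
    (hU : ∀ u ∈ U, ∀ t, t ≠ u → blk A u t = 0) (hsU : s ∉ U) :
    ∃ t ∉ U, ∃ L : Matrix (Fin (d s)) (Fin (d t)) ℝ, L * blk A t s = 1 := by
  have : Nonempty (Fin (d s)) := ⟨⟨0, hs⟩⟩
  obtain ⟨Z, hZ1, hZ2⟩ := isUnit_iff_exists.mp hu
  have hZJ : Z * (blockDiagonal' J)ᵀ = blockDiagonal' J * Z := by
    calc Z * (blockDiagonal' J)ᵀ = Z * ((blockDiagonal' J)ᵀ * A) * Z := by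
          rw [mul_assoc, mul_assoc, hZ1, mul_one]
      _ = blockDiagonal' J * Z := by rw [← hAJ, ← mul_assoc, hZ2, one_mul]
  rw [blockDiagonal'_transpose] at hAJ hZJ
  have hsum : ∑ t, blk Z s t * blk A t s = 1 := by
    rw [← blk_mul, hZ2, blk_one_self]
  have hcomm : ∀ t, Commute (blk Z s t * blk A t s) (J s) := by
    intro t
    rw [Commute, SemiconjBy, Matrix.mul_assoc, blk_mul_of_intertwine hAJ, ← Matrix.mul_assoc,
      blk_mul_of_intertwine hZJ, Matrix.mul_assoc]
  by_contra! hno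
  -- With Z = A⁻¹, the (s, s) block of ZA writes 1 as a sum of commuting elements of a local
  -- commutant. If no summand with t outside U were a unit, the sum would be nilpotent.
  have hnil : IsNilpotent (∑ t, blk Z s t * blk A t s) := by
    refine Commute.isNilpotent_sum (fun t _ => ?_) fun t t' _ _ => hJ.commute (hcomm t) (hcomm t')
    refine (hJ.isUnit_or_isNilpotent _ (hcomm t)).resolve_left fun hunit => ?_
    by_cases ht : t ∈ U
    · rw [hU t ht s (fun h => hsU (h ▸ ht)), Matrix.mul_zero] at hunit
      exact not_isUnit_zero hunit
    · obtain ⟨W, -, hW⟩ := isUnit_iff_exists.mp hunit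
      exact hno t ht (W * blk Z s t) (by rw [Matrix.mul_assoc, hW])
  rw [hsum] at hnil
  exact hnil.not_isUnit isUnit_one

/-- After a congruence which commutes with `J`, some diagonal block is nonsingular. -/
theorem exists_congr_isUnit_blk {U : Finset ι} (hJ : ∀ s, IsLocalBlock (J s) (H s))
    (hd : ∀ s, 0 < d s) (hA : Aᵀ = A) (hu : IsUnit A)
    (hAJ : A * blockDiagonal' J = (blockDiagonal' J)ᵀ * A)
    (hU : ∀ u ∈ U, ∀ t, t ≠ u → blk A u t = 0) (hne : Uᶜ.Nonempty) :
    ∃ s ∉ U, ∃ P, IsUnit P ∧ Commute P (blockDiagonal' J) ∧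
      (∀ u ∈ U, ∀ t, t ≠ u → blk (Pᵀ * A * P) u t = 0) ∧ IsUnit (blk (Pᵀ * A * P) s s) := by
  -- Maximality of the size of block s forces the partner t, where A_ts has a left inverse, to have
  -- the same size, so that A_ts is invertible.
  obtain ⟨s, hsU, hmax⟩ := Finset.exists_max_image Uᶜ d hne
  rw [Finset.mem_compl] at hsU
  obtain ⟨t, htU, L, hL⟩ := exists_left_inverse_blk (hJ s) (hd s) hu hAJ hU hsU
  by_cases hs : IsUnit (blk A s s)
  · exact ⟨s, hsU, 1, isUnit_one, Commute.one_left _, by simpa using hU, by simpa using hs⟩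
  by_cases ht : IsUnit (blk A t t)
  · exact ⟨t, htU, 1, isUnit_one, Commute.one_left _, by simpa using hU, by simpa using ht⟩
  have hts : t ≠ s := by
    rintro rfl
    exact hs (IsUnit.of_mul_eq_one_right _ hL)
  have hdle : d s ≤ d t := by
    have h1 := Matrix.rank_mul_le_right L (blk A t s)
    rw [hL, Matrix.rank_one, Fintype.card_fin] at h1
    simpa using h1.trans (Matrix.rank_le_card_height _)
  have hdeq : d s = d t := le_antisymm hdle (hmax t (Finset.mem_compl.mpr htU))
  have hL' : blk A t s * L = 1 :=
    (Matrix.mul_eq_one_comm_of_card_eq (Fin (d s)) (Fin (d t)) ℝ (by simpa using hdeq)).mp hL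
  have hAJ' := hAJ
  rw [blockDiagonal'_transpose] at hAJ'
  set e := blockIncl d s with he
  set f := blockIncl d t with hf
  have hee : eᵀ * e = 1 := blockIncl_transpose_mul_self s
  have hef : eᵀ * f = 0 := blockIncl_transpose_mul_of_ne hts.symm
  set X := blk A t s with hX
  have hXT : blk A s t = Xᵀ := by rw [hX, transpose_blk, hA]
  have hXJ : X * J s = (J t)ᵀ * X := blk_mul_of_intertwine hAJ' t s
  have hXJ' : Xᵀ * J t = (J s)ᵀ * Xᵀ := by
    rw [← hXT]
    exact blk_mul_of_intertwine hAJ' s t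
  let C := H t * X
  have hCJ : C * J s = J t * C := by
    simp only [C]
    rw [Matrix.mul_assoc, hXJ, ← Matrix.mul_assoc, (hJ t).mul_transpose, Matrix.mul_assoc]
  have hCT : Cᵀ = Xᵀ * H t := by
    simp only [C]
    rw [transpose_mul, (hJ t).transpose_eq]
  have hCJ' : Cᵀ * (J t)ᵀ = (J s)ᵀ * Cᵀ := by
    rw [← transpose_mul, ← hCJ, transpose_mul]
  -- Polarization: when A_ss and A_tt are both singular, block s is replaced by s + t. The map C =
  -- H_t A_ts identifies the two blocks compatibly with J.
  let K := f * (C * eᵀ)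
  have hKe : K * e = f * C := by
    simp only [K, Matrix.mul_assoc, hee, Matrix.mul_one]
  have hKt : ∀ u, u ≠ s → K * blockIncl d u = 0 := by
    intro u hu
    simp only [K, he, Matrix.mul_assoc, blockIncl_transpose_mul_of_ne hu.symm, Matrix.mul_zero]
  have hKK : K * K = 0 := by
    simp only [K, Matrix.mul_assoc]
    rw [← Matrix.mul_assoc eᵀ, hef, Matrix.zero_mul, Matrix.mul_zero, Matrix.mul_zero]
  have hPe : (1 + K) * e = e + f * C := by rw [Matrix.add_mul, hKe, Matrix.one_mul]
  have hPt : ∀ u, u ≠ s → (1 + K) * blockIncl d u = blockIncl d u := by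
    intro u hu
    rw [Matrix.add_mul, hKt u hu, Matrix.one_mul, add_zero]
  refine ⟨s, hsU, 1 + K, isUnit_one_add_of_mul_self hKK, ?_, ?_, ?_⟩
  · refine (Commute.one_left _).add_left ?_
    have h1 : eᵀ * blockDiagonal' J = J s * eᵀ := blockIncl_transpose_mul_blockDiagonal' J s
    have h2 : blockDiagonal' J * f = f * J t := blockDiagonal'_mul_blockIncl J t
    change K * _ = _ * K
    simp only [K]
    rw [Matrix.mul_assoc, Matrix.mul_assoc, h1, ← Matrix.mul_assoc C, hCJ, ← Matrix.mul_assoc _ f,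
      h2]
    simp only [Matrix.mul_assoc]
  · intro u hu v hv
    have hus : u ≠ s := fun h => hsU (h ▸ hu)
    have hut : t ≠ u := fun h => htU (h ▸ hu)
    rw [blk_congr, hPt u hus]
    rcases eq_or_ne v s with rfl | hvs
    · rw [hPe, Matrix.mul_add, ← Matrix.mul_assoc _ f]
      change blk A u _ + blk A u t * C = 0
      rw [hU u hu _ hv, hU u hu t hut, Matrix.zero_mul, add_zero]
    · rw [hPt v hvs]
      exact hU u hu v hv
  -- The two cross terms coincide and, after multiplication by H_s, give a unit; the two remaining
  -- terms become nilpotent. All lie in the commutative commutant of J_s, so the sum is a unit.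
  · have hblk : blk ((1 + K)ᵀ * A * (1 + K)) s s =
        (2 : ℝ) • (Xᵀ * (H t * X)) + (blk A s s + Cᵀ * (blk A t t * C)) := by
      rw [blk_congr, ← he, hPe]
      have e1 : eᵀ * (A * e) = blk A s s := transpose_mul_mul_eq_blk A s s
      have e2 : eᵀ * (A * (f * C)) = Xᵀ * (H t * X) := by
        rw [← Matrix.mul_assoc A, ← Matrix.mul_assoc, transpose_mul_mul_eq_blk, hXT]
      have e3 : Cᵀ * (fᵀ * (A * e)) = Xᵀ * (H t * X) := by
        rw [transpose_mul_mul_eq_blk, hCT, Matrix.mul_assoc]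
      have e4 : Cᵀ * (fᵀ * (A * (f * C))) = Cᵀ * (blk A t t * C) := by
        rw [← Matrix.mul_assoc A, ← Matrix.mul_assoc fᵀ, transpose_mul_mul_eq_blk]
      simp only [transpose_add, transpose_mul, Matrix.add_mul, Matrix.mul_add, Matrix.mul_assoc,
        e1, e2, e3, e4]
      module
    have hM1 : Commute (H s * (Xᵀ * (H t * X))) (J s) := by
      refine (hJ s).commute_mul ?_
      rw [Matrix.mul_assoc, show H t * X * J s = J t * (H t * X) from hCJ, ← Matrix.mul_assoc,
        hXJ', Matrix.mul_assoc]
    have hM2 : Commute (H s * blk A s s) (J s) :=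
      (hJ s).commute_mul (blk_mul_of_intertwine hAJ' s s)
    have hM3 : Commute (H s * (Cᵀ * (blk A t t * C))) (J s) := by
      refine (hJ s).commute_mul ?_
      rw [Matrix.mul_assoc, Matrix.mul_assoc, hCJ, ← Matrix.mul_assoc (blk A t t),
        blk_mul_of_intertwine hAJ' t t, Matrix.mul_assoc, ← Matrix.mul_assoc Cᵀ, hCJ']
      simp only [Matrix.mul_assoc]
    have hLT : Xᵀ * Lᵀ = 1 := by rw [← transpose_mul, hL, transpose_one]
    have hLT' : Lᵀ * Xᵀ = 1 := by rw [← transpose_mul, hL', transpose_one]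
    have hN1 : IsUnit (H s * (Xᵀ * (H t * X))) := by
      refine (hJ s).isUnit.mul (IsUnit.of_mul_eq_one (L * (H t * Lᵀ)) ?_)
      rw [Matrix.mul_assoc, Matrix.mul_assoc, ← Matrix.mul_assoc X, hL', Matrix.one_mul,
        ← Matrix.mul_assoc (H t), (hJ t).mul_self, Matrix.one_mul, hLT]
    have hN2 : IsNilpotent (H s * blk A s s) := by
      refine ((hJ s).isUnit_or_isNilpotent _ hM2).resolve_left fun h => hs ?_
      have := (hJ s).isUnit.mul h
      rwa [← mul_assoc, (hJ s).mul_self, one_mul] at this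
    have hN3 : IsNilpotent (H s * (Cᵀ * (blk A t t * C))) := by
      refine ((hJ s).isUnit_or_isNilpotent _ hM3).resolve_left fun h => ht ?_
      have h1 := (hJ s).isUnit.mul h
      rw [← mul_assoc, (hJ s).mul_self, one_mul] at h1
      obtain ⟨W, hW, -⟩ := isUnit_iff_exists.mp h1
      have hD : H t * Lᵀ * Cᵀ = 1 := by
        rw [hCT, Matrix.mul_assoc, ← Matrix.mul_assoc Lᵀ, hLT', Matrix.one_mul, (hJ t).mul_self]
      have hD' : Cᵀ * (H t * Lᵀ) = 1 := by
        rw [hCT, Matrix.mul_assoc, ← Matrix.mul_assoc (H t), (hJ t).mul_self, Matrix.one_mul, hLT]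
      refine IsUnit.of_mul_eq_one (C * W * Cᵀ) ?_
      calc blk A t t * (C * W * Cᵀ)
          = H t * Lᵀ * Cᵀ * (blk A t t * (C * W * Cᵀ)) := by rw [hD, Matrix.one_mul]
        _ = H t * Lᵀ * (Cᵀ * (blk A t t * C) * W) * Cᵀ := by simp only [Matrix.mul_assoc]
        _ = 1 := by rw [hW, Matrix.mul_one, hD]
    have hfin : IsUnit (H s * blk ((1 + K)ᵀ * A * (1 + K)) s s) := by
      rw [hblk, Matrix.mul_add, Matrix.mul_add, Matrix.mul_smul]
      refine IsNilpotent.isUnit_add_left_of_commute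
        ((hJ s).commute hM2 hM3 |>.isNilpotent_add hN2 hN3) ?_ ?_
      · exact hN1.smul (Units.mk0 (2 : ℝ) two_ne_zero)
      · exact (hJ s).commute (hM2.add_left hM3) (hM1.smul_left _)
    have := (hJ s).isUnit.mul hfin
    rwa [← mul_assoc, (hJ s).mul_self, one_mul] at this

theorem exists_congr_eq_blockDiagonal' (hJ : ∀ s, IsLocalBlock (J s) (H s)) (hd : ∀ s, 0 < d s)
    (hA : Aᵀ = A) (hu : IsUnit A) (hAJ : A * blockDiagonal' J = (blockDiagonal' J)ᵀ * A) :
    ∃ P, IsUnit P ∧ Commute P (blockDiagonal' J) ∧ ∃ X, Pᵀ * A * P = blockDiagonal' X := by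
  -- Induction on the number of blocks outside U, the set of blocks already orthogonal to all
  -- others.
  suffices h : ∀ (k : ℕ) (U : Finset ι) (A : Matrix (Σ s, Fin (d s)) (Σ s, Fin (d s)) ℝ),
      Uᶜ.card = k → Aᵀ = A → IsUnit A → A * blockDiagonal' J = (blockDiagonal' J)ᵀ * A →
      (∀ u ∈ U, ∀ t, t ≠ u → blk A u t = 0) →
      ∃ P, IsUnit P ∧ Commute P (blockDiagonal' J) ∧ ∃ X, Pᵀ * A * P = blockDiagonal' X from
    h _ ∅ A rfl hA hu hAJ (by simp)
  have hcongr : ∀ {A P : Matrix (Σ s, Fin (d s)) (Σ s, Fin (d s)) ℝ}, Aᵀ = A → IsUnit A →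
      IsUnit P → (Pᵀ * A * P)ᵀ = Pᵀ * A * P ∧ IsUnit (Pᵀ * A * P) := by
    intro A P hA hu hP
    refine ⟨by simp [hA, mul_assoc], (IsUnit.mul ?_ hu).mul hP⟩
    exact Matrix.isUnit_transpose P |>.mpr hP
  intro k
  induction k with
  | zero =>
    intro U A hUc _ _ _ hU
    rw [Finset.card_eq_zero, Finset.compl_eq_empty_iff] at hUc
    subst hUc
    refine ⟨1, isUnit_one, Commute.one_left _, fun s => blk A s s, ?_⟩
    rw [transpose_one, one_mul, mul_one]
    exact eq_blockDiagonal'_of_blk fun s t => hU s (Finset.mem_univ s) t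
  | succ k ih =>
    intro U A hUc hA hu hAJ hU
    obtain ⟨s, hsU, P, hP, hPJ, hPU, hPs⟩ := exists_congr_isUnit_blk hJ hd hA hu hAJ hU
      (Finset.card_pos.mp (by omega))
    obtain ⟨hA1, hu1⟩ := hcongr hA hu hP
    have hAJ1 := intertwine_congr hAJ hPJ
    obtain ⟨Q, hQ, hQJ, hQU⟩ := exists_congr_split_block (hJ s) hA1 hAJ1 hPU hPs
    obtain ⟨hA2, hu2⟩ := hcongr hA1 hu1 hQ
    obtain ⟨R, hR, hRJ, X, hX⟩ := ih (insert s U) _ (by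
      rw [Finset.compl_insert, Finset.card_erase_of_mem (Finset.mem_compl.mpr hsU), hUc]
      rfl) hA2 hu2 (intertwine_congr hAJ1 hQJ) hQU
    refine ⟨P * Q * R, (hP.mul hQ).mul hR, (hPJ.mul_left hQJ).mul_left hRJ, X, ?_⟩
    rw [← hX]
    simp only [transpose_mul, mul_assoc]

end Orthogonalization
-- Degenerating a real Jordan block to its diagonal part.
section Limit

open Matrix

theorem isUnit_signMat (m : ℕ) : IsUnit (signMat m) := by
  refine IsUnit.of_mul_eq_one (signMat m) ?_
  rw [signMat, diagonal_mul_diagonal, ← diagonal_one]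
  congr 1
  ext i
  split_ifs <;> norm_num

/-- The vectors e_i ± e_{rev i}, normalized, diagonalize E with values ±1. They are the columns of 1
+ EG. -/
theorem exists_transpose_mul_exchangeMat_mul_eq (m : ℕ) :
    ∃ R : Matrix (Fin m) (Fin m) ℝ, Rᵀ * exchangeMat m * R = signMat m := by
  -- For odd m the middle column of 1 + EG is 2e_i, whence 1/2 there instead of 1/√2.
  let a : Fin m → ℝ := fun i => if 2 * (i : ℕ) + 1 = m then 1 / 2 else 1 / √2
  let G := signMat m
  let E := exchangeMat m
  have hE : Eᵀ = E := transpose_exchangeMat m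
  have hG : Gᵀ = G := diagonal_transpose _
  have hEE : E * E = 1 := exchangeMat_mul_self m
  have h2 : (1 / √2 : ℝ) * (1 / √2) = 1 / 2 := by
    rw [div_mul_div_comm, Real.mul_self_sqrt (by norm_num), one_mul]
  refine ⟨(1 + E * G) * diagonal a, ?_⟩
  have h : ((1 + E * G) * diagonal a)ᵀ * E * ((1 + E * G) * diagonal a) =
      diagonal a * (E + (2 : ℝ) • G + G * E * G) * diagonal a := by
    rw [transpose_mul, diagonal_transpose, transpose_add, transpose_one, transpose_mul, hE, hG]
    have : (1 + G * E) * E * (1 + E * G) = E + (2 : ℝ) • G + G * E * G := by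
      rw [add_mul, mul_assoc G, hEE, mul_one, one_mul, add_mul, mul_add, mul_add, mul_one, mul_one,
        ← mul_assoc, hEE, one_mul, two_smul, mul_assoc]
      abel
    rw [← this]
    simp only [mul_assoc]
  change _ * E * _ = _
  rw [h]
  ext i j
  simp only [G, E, signMat, mul_diagonal, diagonal_mul, Matrix.add_apply, Matrix.smul_apply,
    diagonal_apply,
    exchangeMat, of_apply, a, smul_eq_mul]
  have hi := i.2
  have hj := j.2
  rcases eq_or_ne i j with rfl | hij
  · by_cases hm : 2 * (i : ℕ) + 1 = m
    · rw [if_pos hm, if_pos (show (i : ℕ) + i + 1 = m by omega), if_pos rfl,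
        if_pos (show (i : ℕ) < (m + 1) / 2 by omega)]
      norm_num
    · rw [if_neg hm, if_neg (show ¬ (i : ℕ) + i + 1 = m by omega), if_pos rfl]
      generalize (if (i : ℕ) < (m + 1) / 2 then (1 : ℝ) else -1) = x
      linear_combination (2 * x) * h2
  · rw [if_neg hij]
    by_cases hm : (i : ℕ) + j + 1 = m
    · rw [if_pos hm]
      have hne : (i : ℕ) ≠ j := fun h => hij (Fin.ext h)
      by_cases hlt : (i : ℕ) < (m + 1) / 2
      · rw [if_pos hlt, if_neg (show ¬ (j : ℕ) < (m + 1) / 2 by omega)]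
        ring
      · rw [if_neg hlt, if_pos (show (j : ℕ) < (m + 1) / 2 by omega)]
        ring
    · rw [if_neg hm]
      ring

/-- The scaling weights which preserve the anti-diagonal form. -/
noncomputable def scalingWeight (m : ℕ) (t : ℝ) (i : Fin m) : ℝ := t ^ ((m : ℤ) - 1 - 2 * (i : ℤ))

theorem scalingWeight_conj_exchangeMat {m : ℕ} {t : ℝ} (ht : 0 < t) :
    diagonal (scalingWeight m t) * exchangeMat m * diagonal (scalingWeight m t) =
      exchangeMat m := by
  ext i j
  simp only [mul_diagonal, diagonal_mul, exchangeMat, of_apply, scalingWeight]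
  split_ifs with h
  · rw [mul_one, ← zpow_add₀ ht.ne']
    convert zpow_zero t using 2
    omega
  · ring

/-- Taking determinants in the invariance of E gives square 1, and the weights are positive. -/
theorem prod_scalingWeight {m : ℕ} {t : ℝ} (ht : 0 < t) : ∏ i, scalingWeight m t i = 1 := by
  have h := congrArg det (scalingWeight_conj_exchangeMat (m := m) ht)
  have hE : (exchangeMat m).det ≠ 0 := by
    intro h0
    have := congrArg det (exchangeMat_mul_self m)
    simp [h0] at this
  rw [det_mul, det_mul, det_diagonal] at h
  have hpos : 0 < ∏ i, scalingWeight m t i := Finset.prod_pos fun i _ => zpow_pos ht _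
  have h1 : (∏ i, scalingWeight m t i) ^ 2 = 1 := by
    refine mul_right_cancel₀ hE ?_
    linear_combination h
  exact (pow_eq_one_iff_of_nonneg hpos.le two_ne_zero).mp h1

/-- The nonzero entries of EN lie on i + j = m, where the exponents add up to 2(m-1) - 2m = -2. -/
theorem scalingWeight_conj_shiftMat {m : ℕ} {t : ℝ} (ht : 0 < t) :
    diagonal (scalingWeight m t) * (exchangeMat m * shiftMat ℝ m) * diagonal (scalingWeight m t) =
      (t ^ 2)⁻¹ • (exchangeMat m * shiftMat ℝ m) := by
  ext i j
  simp only [mul_diagonal, diagonal_mul, exchangeMat_mul_apply, shiftMat_apply, scalingWeight,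
    Matrix.smul_apply, Fin.val_rev, smul_eq_mul]
  split_ifs with h
  · rw [mul_one, mul_one, ← zpow_add₀ ht.ne', ← zpow_natCast, ← _root_.zpow_neg]
    congr 1
    have := i.2
    push_cast
    omega
  · ring

/-- For a real Jordan block, the pair `(E, E J)` is congruent to pairs `(G, B_k)` with
`B_k → c G`. -/
theorem exists_seq_congr_tendsto (c : ℝ) (m : ℕ) :
    ∃ (v : ℕ → Fin m → ℝ) (R : Matrix (Fin m) (Fin m) ℝ), (∀ k, ∏ i, v k i = 1) ∧ IsUnit R ∧
      (∀ k, (diagonal (v k) * R)ᵀ * exchangeMat m * (diagonal (v k) * R) = signMat m) ∧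
      Tendsto (fun k => (diagonal (v k) * R)ᵀ * (exchangeMat m * realEigJordanBlock c m) *
        (diagonal (v k) * R)) atTop (𝓝 (c • signMat m)) := by
  obtain ⟨R, hR⟩ := exists_transpose_mul_exchangeMat_mul_eq m
  -- The scaling parameter is t = k + 1, positive from k = 0 on.
  have hpos : ∀ k : ℕ, (0 : ℝ) < k + 1 := fun k => by positivity
  have hcongr : ∀ (k : ℕ) (M : Matrix (Fin m) (Fin m) ℝ),
      (diagonal (scalingWeight m (k + 1)) * R)ᵀ * M * (diagonal (scalingWeight m (k + 1)) * R) =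
        Rᵀ * (diagonal (scalingWeight m (k + 1)) * M * diagonal (scalingWeight m (k + 1))) * R := by
    intro k M
    rw [transpose_mul, diagonal_transpose]
    simp only [mul_assoc]
  have hEk : ∀ k : ℕ, (diagonal (scalingWeight m (k + 1)) * R)ᵀ * exchangeMat m *
      (diagonal (scalingWeight m (k + 1)) * R) = signMat m := by
    intro k
    rw [hcongr, scalingWeight_conj_exchangeMat (hpos k), hR]
  refine ⟨fun k => scalingWeight m (k + 1), R, fun k => prod_scalingWeight (hpos k), ?_, hEk, ?_⟩
  · have h := isUnit_signMat m
    rw [← hR, isUnit_iff_isUnit_det, det_mul] at h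
    exact (isUnit_iff_isUnit_det _).mpr (isUnit_of_mul_isUnit_right h)
  · have h : ∀ k : ℕ, (diagonal (scalingWeight m (k + 1)) * R)ᵀ *
        (exchangeMat m * realEigJordanBlock c m) * (diagonal (scalingWeight m (k + 1)) * R) =
        c • signMat m + (((k : ℝ) + 1) ^ 2)⁻¹ • (Rᵀ * (exchangeMat m * shiftMat ℝ m) * R) := by
      intro k
      rw [realEigJordanBlock_eq, mul_add, mul_add, add_mul, Algebra.algebraMap_eq_smul_one,
        mul_smul_comm, mul_one, mul_smul_comm, smul_mul_assoc, hEk, hcongr,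
        scalingWeight_conj_shiftMat (hpos k), mul_smul_comm, smul_mul_assoc]
    simp only [h]
    have ht : Tendsto (fun k : ℕ => (((k : ℝ) + 1) ^ 2)⁻¹) atTop (𝓝 0) :=
      (((tendsto_pow_atTop two_ne_zero).comp
        (tendsto_atTop_add_const_right _ 1 tendsto_natCast_atTop_atTop))).inv_tendsto_atTop
    simpa using tendsto_const_nhds.add (ht.smul_const (Rᵀ * (exchangeMat m * shiftMat ℝ m) * R))

end Limit
-- Assembling the blocks: existence of signs and the limit.
section Assembly

open Matrix

variable {p m : ℕ} {d : Fin p → ℕ}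

/-- Reindexing of matrices along the identification of `Σ s, Fin (d s)` with `Fin m`. -/
def blockReindex (h : ∑ s, d s = m) :
    Matrix (Σ s, Fin (d s)) (Σ s, Fin (d s)) ℝ ≃ₐ[ℝ] Matrix (Fin m) (Fin m) ℝ :=
  Matrix.reindexAlgEquiv ℝ ℝ (finSigmaFinEquiv.trans (finCongr h))

theorem blockReindex_transpose (h : ∑ s, d s = m)
    (M : Matrix (Σ s, Fin (d s)) (Σ s, Fin (d s)) ℝ) :
    (blockReindex h M)ᵀ = blockReindex h Mᵀ := rfl

theorem blockReindex_blockDiagonal' (h : ∑ s, d s = m)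
    (X : ∀ s, Matrix (Fin (d s)) (Fin (d s)) ℝ) :
    blockReindex h (blockDiagonal' X) = blockDiag h X := rfl

theorem blockDiag_mul (h : ∑ s, d s = m) (X Y : ∀ s, Matrix (Fin (d s)) (Fin (d s)) ℝ) :
    blockDiag h X * blockDiag h Y = blockDiag h fun s => X s * Y s := by
  simp only [← blockReindex_blockDiagonal', ← map_mul, ← blockDiagonal'_mul]

theorem transpose_blockDiag (h : ∑ s, d s = m) (X : ∀ s, Matrix (Fin (d s)) (Fin (d s)) ℝ) :
    (blockDiag h X)ᵀ = blockDiag h fun s => (X s)ᵀ := by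
  simp only [← blockReindex_blockDiagonal', blockReindex_transpose, blockDiagonal'_transpose]

theorem isUnit_blockDiagonal' {X : ∀ s, Matrix (Fin (d s)) (Fin (d s)) ℝ}
    (hX : ∀ s, IsUnit (X s)) : IsUnit (blockDiagonal' X) :=
  (Pi.isUnit_iff.mpr hX).map (blockDiagonal'RingHom (fun s => Fin (d s)) ℝ)

theorem isUnit_blockDiag (h : ∑ s, d s = m) {X : ∀ s, Matrix (Fin (d s)) (Fin (d s)) ℝ}
    (hX : ∀ s, IsUnit (X s)) : IsUnit (blockDiag h X) :=
  (isUnit_blockDiagonal' hX).map (blockReindex h)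

theorem isUnit_of_isUnit_blockDiagonal' {X : ∀ s, Matrix (Fin (d s)) (Fin (d s)) ℝ}
    (hX : IsUnit (blockDiagonal' X)) (s : Fin p) : IsUnit (X s) := by
  obtain ⟨Z, -, hZ⟩ := isUnit_iff_exists.mp hX
  refine IsUnit.of_mul_eq_one_right (blk Z s s) ?_
  rw [blk, Matrix.mul_assoc, ← blockDiagonal'_mul_blockIncl, ← Matrix.mul_assoc,
    Matrix.mul_assoc _ Z, hZ, Matrix.mul_one, blockIncl_transpose_mul_self]

theorem det_blockDiag_diagonal (h : ∑ s, d s = m) (v : ∀ s, Fin (d s) → ℝ) :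
    (blockDiag h fun s => diagonal (v s)).det = ∏ s, ∏ i, v s i := by
  rw [_root_.blockDiag, Matrix.det_reindex_self, blockDiagonal'_diagonal, det_diagonal,
    Fintype.prod_sigma]

theorem continuous_blockDiag (h : ∑ s, d s = m) :
    Continuous fun X : ∀ s, Matrix (Fin (d s)) (Fin (d s)) ℝ => blockDiag h X :=
  (Continuous.matrix_blockDiagonal' continuous_id).matrix_reindex _ _

theorem isLocalBlock_jordanBlock {z : ℂ} {n : ℕ} (hn : z.im ≠ 0 → Even n) :
    IsLocalBlock (jordanBlock z n) (exchangeMat n) := by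
  unfold jordanBlock
  split_ifs with hz
  · exact isLocalBlock_realEigJordanBlock _ _
  · obtain ⟨k, rfl⟩ := (hn hz).exists_two_nsmul
    rw [smul_eq_mul, mul_comm]
    exact isLocalBlock_complexEigJordanBlock hz k

theorem exists_conj_eq_sign_of_commute_jordanBlock {z : ℂ} {n : ℕ} (hn0 : 0 < n)
    (hn : z.im ≠ 0 → Even n) {X : Matrix (Fin n) (Fin n) ℝ} (hX : Commute X (jordanBlock z n))
    (hu : IsUnit X) :
    ∃ (σ : ℝ) (Q : Matrix (Fin n) (Fin n) ℝ), (σ = 1 ∨ σ = -1) ∧ (z.im ≠ 0 → σ = 1) ∧ IsUnit Q ∧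
      Commute Q (jordanBlock z n) ∧ Q * X * Q = σ • 1 := by
  unfold jordanBlock at hX ⊢
  split_ifs with hz
  · rw [if_pos hz] at hX
    obtain ⟨σ, Q, hσ, hQ, hQJ, h⟩ :=
      exists_conj_eq_sign_of_commute_realEigJordanBlock hn0 hX hu
    exact ⟨σ, Q, hσ, fun h => absurd hz h, hQ, hQJ, h⟩
  · rw [if_neg hz] at hX
    obtain ⟨k, rfl⟩ : ∃ k, n = k * 2 := (hn hz).exists_two_nsmul.imp fun k hk => by
      rw [hk, smul_eq_mul, mul_comm]
    obtain ⟨Q, hQ, hQJ, h⟩ :=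
      exists_conj_eq_one_of_commute_complexEigJordanBlock hz (by omega) hX hu
    exact ⟨1, Q, Or.inl rfl, fun _ => rfl, hQ, hQJ, by rw [h, one_smul]⟩

/-- Canonical form of a nonsingular symmetric matrix `A` for which a real Jordan matrix is
self-adjoint, under congruences commuting with the Jordan matrix. -/
theorem exists_congr_eq_blockDiagonal'_sign {lam : Fin p → ℂ} (hd : ∀ s, 0 < d s)
    (heven : ∀ s, (lam s).im ≠ 0 → Even (d s))
    {A : Matrix (Σ s, Fin (d s)) (Σ s, Fin (d s)) ℝ} (hA : Aᵀ = A) (hu : IsUnit A)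
    (hAJ : A * blockDiagonal' (fun s => jordanBlock (lam s) (d s)) =
      (blockDiagonal' fun s => jordanBlock (lam s) (d s))ᵀ * A) :
    ∃ (σ : Fin p → ℝ) (P : Matrix (Σ s, Fin (d s)) (Σ s, Fin (d s)) ℝ),
      (∀ s, σ s = 1 ∨ σ s = -1) ∧ (∀ s, (lam s).im ≠ 0 → σ s = 1) ∧ IsUnit P ∧
      Commute P (blockDiagonal' fun s => jordanBlock (lam s) (d s)) ∧
      Pᵀ * A * P = blockDiagonal' fun s => σ s • exchangeMat (d s) := by
  have hloc := fun s => isLocalBlock_jordanBlock (heven s)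
  obtain ⟨P, hP, hPJ, X, hX⟩ := exists_congr_eq_blockDiagonal' hloc hd hA hu hAJ
  have hXu : ∀ s, IsUnit (X s) := by
    refine isUnit_of_isUnit_blockDiagonal' ?_
    rw [← hX]
    exact (((Matrix.isUnit_transpose P).mpr hP).mul hu).mul hP
  have hXJ : ∀ s, X s * jordanBlock (lam s) (d s) = (jordanBlock (lam s) (d s))ᵀ * X s := by
    have h := intertwine_congr hAJ hPJ
    rw [hX, blockDiagonal'_transpose, ← blockDiagonal'_mul, ← blockDiagonal'_mul] at h
    exact congrFun (blockDiagonal'_injective h)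
  choose σ Q hσ hσ1 hQ hQJ hQX using fun s => exists_conj_eq_sign_of_commute_jordanBlock (hd s)
    (heven s) ((hloc s).commute_mul (hXJ s)) ((hloc s).isUnit.mul (hXu s))
  refine ⟨σ, P * blockDiagonal' Q, hσ, hσ1, hP.mul (isUnit_blockDiagonal' hQ),
    hPJ.mul_left ?_, ?_⟩
  · rw [Commute, SemiconjBy, ← blockDiagonal'_mul, ← blockDiagonal'_mul]
    exact congrArg _ (funext fun s => (hQJ s).eq)
  · have h1 : (P * blockDiagonal' Q)ᵀ * A * (P * blockDiagonal' Q) =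
        (blockDiagonal' Q)ᵀ * (Pᵀ * A * P) * blockDiagonal' Q := by
      rw [transpose_mul]
      simp only [Matrix.mul_assoc]
    rw [h1, hX, blockDiagonal'_transpose, ← blockDiagonal'_mul, ← blockDiagonal'_mul]
    refine congrArg _ (funext fun s => ?_)
    -- Self-adjointness of Q gives QᵀE = EQ, so congruence of X by Q becomes the two-sided product
    -- Q(EX)Q.
    calc (Q s)ᵀ * X s * Q s
        = (Q s)ᵀ * (exchangeMat (d s) * exchangeMat (d s)) * X s * Q s := by
          rw [exchangeMat_mul_self, Matrix.mul_one]
      _ = exchangeMat (d s) * (Q s * (exchangeMat (d s) * X s) * Q s) := by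
          rw [← Matrix.mul_assoc _ (exchangeMat (d s)), ← (hloc s).mul_eq _ (hQJ s)]
          simp only [Matrix.mul_assoc]
      _ = σ s • exchangeMat (d s) := by rw [hQX, Matrix.mul_smul, Matrix.mul_one]

theorem exists_isCanonicalSigns (A B : Matrix (Fin m) (Fin m) ℝ)
    (hA : A.IsSymm) (hB : B.IsSymm) (hdet : A.det ≠ 0)
    (r : ℕ) (lam : Fin p → ℂ) (hd : ∑ s, d s = m)
    (hJ : IsRealJordanForm (A⁻¹ * B) r lam d hd) :
    ∃ σ : Fin p → ℝ, IsCanonicalSigns A B r lam d hd σ := by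
  obtain ⟨-, hpos, hre, him, S, hS⟩ := hJ
  have hAu : IsUnit A := (isUnit_iff_isUnit_det A).mpr (isUnit_iff_ne_zero.mpr hdet)
  have heven : ∀ s, (lam s).im ≠ 0 → Even (d s) := fun s hs =>
    (him s (not_lt.mp fun h => hs (hre s h))).2
  set T : Matrix (Fin m) (Fin m) ℝ := S.val with hT
  have hTu : IsUnit T := S.isUnit
  have hTdet : IsUnit T.det := (isUnit_iff_isUnit_det T).mp hTu
  set Jm := blockDiag hd fun s => jordanBlock (lam s) (d s) with hJm
  have hBS : B * T = A * T * Jm := by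
    rw [← hS, ← Matrix.mul_assoc, ← Matrix.mul_assoc, Matrix.mul_assoc A T,
      mul_nonsing_inv _ hTdet, Matrix.mul_one, ← Matrix.mul_assoc,
      mul_nonsing_inv _ (isUnit_iff_ne_zero.mpr hdet), Matrix.one_mul]
  set e := blockReindex hd with he
  obtain ⟨A', hA'⟩ := e.surjective (Tᵀ * A * T)
  have hA'symm : A'ᵀ = A' := by
    apply e.injective
    rw [he, ← blockReindex_transpose, ← he, hA']
    simp only [transpose_mul, transpose_transpose, hA.eq, Matrix.mul_assoc]
  have hA'u : IsUnit A' := by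
    have h : IsUnit (e A') := by
      rw [hA']
      exact (((Matrix.isUnit_transpose T).mpr hTu).mul hAu).mul hTu
    simpa using h.map e.symm
  have hA'J : A' * blockDiagonal' (fun s => jordanBlock (lam s) (d s)) =
      (blockDiagonal' fun s => jordanBlock (lam s) (d s))ᵀ * A' := by
    apply e.injective
    rw [map_mul, map_mul, he, ← blockReindex_transpose, blockReindex_blockDiagonal', ← he, hA',
      ← hJm, Matrix.mul_assoc, Matrix.mul_assoc, ← Matrix.mul_assoc A, ← hBS]
    have h := congrArg transpose hBS
    rw [transpose_mul, transpose_mul, transpose_mul, hB.eq, hA.eq] at h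
    rw [← Matrix.mul_assoc, h]
    simp only [Matrix.mul_assoc]
  obtain ⟨σ, P, hσ, hσ1, hP, hPJ, hPA⟩ :=
    exists_congr_eq_blockDiagonal'_sign hpos heven hA'symm hA'u hA'J
  have hQu : IsUnit (T * e P) := hTu.mul (hP.map e)
  have hQA : (T * e P)ᵀ * A * (T * e P) = blockDiag hd fun s => σ s • exchangeMat (d s) := by
    rw [← blockReindex_blockDiagonal', ← hPA, map_mul, map_mul, ← he, hA', he,
      ← blockReindex_transpose, transpose_mul]
    simp only [Matrix.mul_assoc]
  have hQB : (T * e P)ᵀ * B * (T * e P) =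
      blockDiag hd fun s => σ s • (exchangeMat (d s) * jordanBlock (lam s) (d s)) := by
    have h : Jm * e P = e P * Jm := by
      rw [hJm, ← blockReindex_blockDiagonal', ← he, ← map_mul, ← map_mul, hPJ.eq]
    -- Because P commutes with the Jordan matrix, the form of B is that of A times it.
    have h' : (T * e P)ᵀ * B * (T * e P) = (T * e P)ᵀ * A * (T * e P) * Jm := by
      calc (T * e P)ᵀ * B * (T * e P) = (T * e P)ᵀ * (B * T * e P) := by
            simp only [Matrix.mul_assoc]
        _ = (T * e P)ᵀ * (A * T * (Jm * e P)) := by rw [hBS, Matrix.mul_assoc _ Jm]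
        _ = _ := by
          rw [h]
          simp only [Matrix.mul_assoc]
    rw [h', hQA, hJm, blockDiag_mul]
    simp only [Matrix.smul_mul]
  refine ⟨σ, fun s _ => hσ s, hQu.unit, ?_, ?_⟩
  · rw [IsUnit.unit_spec, hQA]
    congr 1
    funext s
    split_ifs with h
    · rfl
    · rw [hσ1 s (him s (not_lt.mp h)).1, one_smul]
  · rw [IsUnit.unit_spec, hQB]
    congr 1
    funext s
    split_ifs with h
    · rfl
    · rw [hσ1 s (him s (not_lt.mp h)).1, one_smul]

theorem exists_seq_congr_tendsto_of_isCanonicalSigns {A B : Matrix (Fin m) (Fin m) ℝ}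
    {r : ℕ} {lam : Fin p → ℂ} {hd : ∑ s, d s = m}
    (hre : ∀ s : Fin p, (s : ℕ) < r → (lam s).im = 0)
    {σ : Fin p → ℝ} (hσ : IsCanonicalSigns A B r lam d hd σ) :
    ∃ P : ℕ → Matrix.GeneralLinearGroup (Fin m) ℝ,
      (∃ c : ℝ, ∀ k, (P k : Matrix (Fin m) (Fin m) ℝ).det = c) ∧
      (∀ k, (P k : Matrix (Fin m) (Fin m) ℝ)ᵀ * A * (P k : Matrix (Fin m) (Fin m) ℝ) =
        blockDiag hd fun s =>
          if (s : ℕ) < r then σ s • signMat (d s) else exchangeMat (d s)) ∧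
      Tendsto
        (fun k => (P k : Matrix (Fin m) (Fin m) ℝ)ᵀ * B * (P k : Matrix (Fin m) (Fin m) ℝ))
        atTop
        (𝓝 (blockDiag hd fun s =>
          if (s : ℕ) < r then ((lam s).re * σ s) • signMat (d s)
          else exchangeMat (d s) * jordanBlock (lam s) (d s))) := by
  obtain ⟨-, P₀, hPA, hPB⟩ := hσ
  have hPu : IsUnit P₀.val := P₀.isUnit
  generalize P₀.val = P at hPA hPB hPu
  have hblock : ∀ s, ∃ (v : ℕ → Fin (d s) → ℝ) (R : Matrix (Fin (d s)) (Fin (d s)) ℝ),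
      (∀ k, ∏ i, v k i = 1) ∧ IsUnit R ∧
      (∀ k, (diagonal (v k) * R)ᵀ *
        (if (s : ℕ) < r then σ s • exchangeMat (d s) else exchangeMat (d s)) *
        (diagonal (v k) * R) =
          if (s : ℕ) < r then σ s • signMat (d s) else exchangeMat (d s)) ∧
      Tendsto (fun k => (diagonal (v k) * R)ᵀ *
        (if (s : ℕ) < r then σ s • (exchangeMat (d s) * jordanBlock (lam s) (d s))
          else exchangeMat (d s) * jordanBlock (lam s) (d s)) * (diagonal (v k) * R)) atTop
        (𝓝 (if (s : ℕ) < r then ((lam s).re * σ s) • signMat (d s)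
          else exchangeMat (d s) * jordanBlock (lam s) (d s))) := by
    intro s
    split_ifs with h
    · obtain ⟨v, R, hv, hR, hE, hlim⟩ := exists_seq_congr_tendsto (lam s).re (d s)
      refine ⟨v, R, hv, hR, fun k => ?_, ?_⟩
      · rw [Matrix.mul_smul, Matrix.smul_mul, hE]
      · rw [jordanBlock, if_pos (hre s h), mul_comm, mul_smul]
        simpa only [Matrix.mul_smul, Matrix.smul_mul] using hlim.const_smul (σ s)
    -- Blocks with s ≥ r already have the target form: the constant sequence works.
    · exact ⟨fun _ _ => 1, 1, by simp, isUnit_one, by simp, by simp⟩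
  choose v R hv hR hE hlim using hblock
  have hmid : ∀ k (M : Matrix (Fin m) (Fin m) ℝ),
      (P * blockDiag hd (fun s => diagonal (v s k)) * blockDiag hd R)ᵀ * M *
        (P * blockDiag hd (fun s => diagonal (v s k)) * blockDiag hd R) =
      (blockDiag hd fun s => (diagonal (v s k) * R s)ᵀ) *
        (Pᵀ * M * P) *
        blockDiag hd fun s => diagonal (v s k) * R s := by
    intro k M
    rw [← blockDiag_mul, ← transpose_blockDiag, ← blockDiag_mul]
    simp only [transpose_mul, Matrix.mul_assoc]
  have hQu : ∀ k, IsUnit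
      (P * blockDiag hd (fun s => diagonal (v s k)) * blockDiag hd R) := by
    intro k
    refine (hPu.mul ?_).mul (isUnit_blockDiag hd hR)
    rw [isUnit_iff_isUnit_det, det_blockDiag_diagonal]
    simp [hv]
  -- Only the diagonal scaling depends on k, and it has determinant 1.
  refine ⟨fun k => (hQu k).unit,
    ⟨P.det * (blockDiag hd R).det, fun k => ?_⟩, fun k => ?_, ?_⟩
  · rw [IsUnit.unit_spec, det_mul, det_mul, det_blockDiag_diagonal]
    simp [hv]
  · rw [IsUnit.unit_spec, hmid, hPA, blockDiag_mul, blockDiag_mul]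
    exact congrArg _ (funext fun s => hE s k)
  · simp only [IsUnit.unit_spec, hmid, hPB, blockDiag_mul]
    exact ((continuous_blockDiag hd).tendsto _).comp (tendsto_pi_nhds.mpr hlim)

end Assembly

theorem mainTheorem2 {m p : ℕ} (A B : Matrix (Fin m) (Fin m) ℝ)
    (hA : A.IsSymm) (hB : B.IsSymm) (hdet : A.det ≠ 0)
    (r : ℕ) (lam : Fin p → ℂ) (d : Fin p → ℕ) (hd : ∑ s, d s = m)
    (hJ : IsRealJordanForm (A⁻¹ * B) r lam d hd) :
    (∃ σ : Fin p → ℝ, IsCanonicalSigns A B r lam d hd σ) ∧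
    ∀ σ : Fin p → ℝ, IsCanonicalSigns A B r lam d hd σ →
      ∃ P : ℕ → Matrix.GeneralLinearGroup (Fin m) ℝ,
        (∃ c : ℝ, ∀ k, (P k : Matrix (Fin m) (Fin m) ℝ).det = c) ∧
        (∀ k, (P k : Matrix (Fin m) (Fin m) ℝ)ᵀ * A * (P k : Matrix (Fin m) (Fin m) ℝ) =
          blockDiag hd fun s =>
            if (s : ℕ) < r then σ s • signMat (d s) else exchangeMat (d s)) ∧
        Tendsto
          (fun k => (P k : Matrix (Fin m) (Fin m) ℝ)ᵀ * B * (P k : Matrix (Fin m) (Fin m) ℝ))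
          atTop
          (𝓝 (blockDiag hd fun s =>
            if (s : ℕ) < r then ((lam s).re * σ s) • signMat (d s)
            else exchangeMat (d s) * jordanBlock (lam s) (d s))) :=
  ⟨exists_isCanonicalSigns A B hA hB hdet r lam hd hJ, fun _ hσ =>
    exists_seq_congr_tendsto_of_isCanonicalSigns hJ.2.2.1 hσ⟩
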